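/- Let $m,n\ge 0$. Let $\mathrm{R}$ be a rectangle with $2(m+n)$ marked boundary points: $x_1,\dots,x_n$ on the top side and $x'_1,\dots,x'_n$ on the bottom side (from left to right), $y_1,\dots,y_m$ on the left side and $y'_1,\dots,y'_m$ on the right side (from top to bottom). Let $\mathrm{Cat}(m,n)$ be the set of crossingless connections in $\mathrm{R}$, i.e. systems of $m+n$ pairwise disjoint arcs in $\mathrm{R}$ joining these points in pairs, up to isotopy fixing the boundary. A Kauffman state $s$ assigns a marker $\pm1$ to each crossing of the $m$ horizontal lines (joining $y_j$ to $y'_j$) and the $n$ vertical lines (joining $x_i$ to $x'_i$). Each crossing is smoothed according to its marker: a positive marker joins the upper branch to the right one and the left branch to the lower one, a negative marker joins the upper branch to the left one and the right branch to the lower one. Removing the closed components of the result gives $C_s\in\mathrm{Cat}(m,n)$. A state $C\in\mathrm{Cat}(m,n)$ is realizable if $C=C_s$ for some $s$, and it has no bottom returns if no arc of $C$ joins two points of the bottom side. A sequence $\mathbf b=(b_1,\dots,b_m)$ with $0\le b_j\le n$ realizes $C$ if $C=C_s$ for the Kauffman state $s$ whose $j$-th row (from the top) consists of $b_j$ positive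 markers followed by $n-b_j$ negative ones. A maximal sequence of $C$ is a sequence realizing $C$ for which $b_1+\cdots+b_m$ is largest. Put $\iota(y'_i)=i$ and $\iota(y_i)=-n+1-i$ for $1\le i\le m$, and $\iota(x_i)=i-n$ for $1\le i\le n$. Let $S(C)$ be the set of arcs $(p,q)$ of $C$ with no end on the bottom side, where the left end $p$ and the right end $q$ are named so that $\iota(p)<\iota(q)$. **Corollary.** Let $C\in\mathrm{Cat}(m,n)$ be realizable with no bottom returns. Put $$S_1=\{(p,q)\in S(C):\iota(p)+\iota(q)\ge 1\},\qquad S_2=S(C)\setminus S_1,$$ $$I_1=\{\iota(q):(p,q)\in S_1\},\qquad I_2=\{1,\dots,m\}\setminus I_1,\qquad I_3=\{\iota(p):(p,q)\in S_2\}.$$ Then $C$ has a unique maximal sequence $\mathbf b=(b_1,\dots,b_m)$. Moreover $I_1\subseteq\{1,\dots,m\}$, the sets $I_2$ and $I_3$ both have $s=|S_2|$ elements, and if $I_2=\{i_1<i_2<\cdots<i_s\}$ and $I_3=\{l_1>l_2>\cdots>l_s\}$, then $$b_j=n\ \text{ for } j\in I_1\qquad\text{and}\qquad b_{i_j}=n+(i_j-1)+l_j\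 \text{ for } j=1,2,\dots,s.$$ -/

import Mathlib

namespace LatticeCrossing

/-- The `2 (m + n)` marked points on the boundary of the rectangle, numbered from `0`:
`top i` is `x_{i+1}` and `bottom i` is `x'_{i+1}` (from left to right), `left j` is `y_{j+1}` and
`right j` is `y'_{j+1}` (from top to bottom). -/
inductive BoundaryPoint (m n : ℕ) : Type
  | top (i : Fin n)
  | bottom (i : Fin n)
  | left (j : Fin m)
  | right (j : Fin m)

/-- The coordinate of a boundary point.  On the top, left and right sides it is the coordinate
function `ι_{m,n}`: `ι (y'_i) = i`, `ι (x_i) = i - n` (as `x_i = y'_{i-n}`) and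
`ι (y_i) = -n + 1 - i`.  It is continued to the bottom side by `x'_i = y'_{m+(n-i)+1}`, so that
the coordinate increases when one runs clockwise around the boundary from the lower left corner. -/
def BoundaryPoint.iota {m n : ℕ} : BoundaryPoint m n → ℤ
  | .left j => -(n : ℤ) + 1 - ((j : ℤ) + 1)
  | .top i => ((i : ℤ) + 1) - n
  | .right j => (j : ℤ) + 1
  | .bottom i => (m : ℤ) + ((n : ℤ) - ((i : ℤ) + 1)) + 1

/-- The point lies on the bottom side. -/
def BoundaryPoint.IsBottom {m n : ℕ} (p : BoundaryPoint m n) : Prop :=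
  ∃ i : Fin n, p = .bottom i

/-- A Catalan state, i.e. an element of `Cat(m,n)`: a crossingless connection (up to isotopy fixing
the boundary) of the `2 (m + n)` boundary points, given as a non-crossing perfect matching.
The arcs are the pairs `{p, mate p}`. -/
@[ext]
structure CatalanState (m n : ℕ) where
  mate : BoundaryPoint m n → BoundaryPoint m n
  mate_mate : ∀ p, mate (mate p) = p
  mate_ne : ∀ p, mate p ≠ p
  noncrossing : ∀ p q, ¬ (p.iota < q.iota ∧ q.iota < (mate p).iota ∧
    (mate p).iota < (mate q).iota)

/-- The two markers of a crossing. -/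
inductive Marker : Type
  | pos
  | neg

/-- A Kauffman state of the lattice crossing `L(m,n)`: a marker at the crossing of row `i` and
column `j`, for all `i` and `j` (rows from top to bottom, columns from left to right). -/
abbrev KauffmanState (m n : ℕ) : Type := Fin m → Fin n → Marker

/-- The segments into which the crossings cut the `m` horizontal and the `n` vertical lines of
`L(m,n)`: `hor i k` is the `k`-th segment (from the left) of the `i`-th horizontal line,
`ver k j` is the `k`-th segment (from the top) of the `j`-th vertical line. -/
inductive Segment (m n : ℕ) : Type
  | hor (i : Fin m) (k : Fin (n + 1))
  | ver (k : Fin (m + 1)) (j : Fin n)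

/-- The segment that ends at a given boundary point. -/
def BoundaryPoint.segment {m n : ℕ} : BoundaryPoint m n → Segment m n
  | .top i => .ver 0 i
  | .bottom i => .ver (Fin.last m) i
  | .left j => .hor j 0
  | .right j => .hor j (Fin.last n)

/-- Smoothing of the crossings according to the markers.  At a crossing, the positive marker joins
the upper segment to the right one and the left segment to the lower one; the negative marker joins
the upper segment to the left one and the right segment to the lower one. -/
inductive Smoothing {m n : ℕ} (s : KauffmanState m n) : Segment m n → Segment m n → Prop
  | pos_upper (i : Fin m) (j : Fin n) (h : s i j = .pos) :
      Smoothing s (.ver i.castSucc j) (.hor i j.succ)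
  | pos_lower (i : Fin m) (j : Fin n) (h : s i j = .pos) :
      Smoothing s (.hor i j.castSucc) (.ver i.succ j)
  | neg_upper (i : Fin m) (j : Fin n) (h : s i j = .neg) :
      Smoothing s (.ver i.castSucc j) (.hor i j.castSucc)
  | neg_lower (i : Fin m) (j : Fin n) (h : s i j = .neg) :
      Smoothing s (.hor i j.succ) (.ver i.succ j)

/-- Two segments lie on the same component of the smoothed diagram `D_s`. -/
def SameComponent {m n : ℕ} (s : KauffmanState m n) : Segment m n → Segment m n → Prop :=
  Relation.EqvGen (Smoothing s)

/-- `C = C_s`: two different boundary points are the ends of an arc of `C` if and only if they lie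
on the same component of `D_s` (closed components of `D_s` play no role). -/
def KauffmanState.Realizes {m n : ℕ} (s : KauffmanState m n) (C : CatalanState m n) : Prop :=
  ∀ p q : BoundaryPoint m n, p ≠ q → (C.mate p = q ↔ SameComponent s p.segment q.segment)

/-- The Kauffman state whose `j`-th row is `b_j` positive markers followed by negative ones. -/
def rowState {m n : ℕ} (b : Fin m → ℕ) : KauffmanState m n :=
  fun j k => if (k : ℕ) < b j then .pos else .neg

namespace CatalanState

variable {m n : ℕ}

/-- `C` is realizable: `C = C_s` for some Kauffman state `s` of `L(m,n)`. -/
def Realizable (C : CatalanState m n) : Prop :=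
  ∃ s : KauffmanState m n, s.Realizes C

/-- No arc of `C` joins two bottom-boundary points. -/
def NoBottomReturns (C : CatalanState m n) : Prop :=
  ∀ p : BoundaryPoint m n, p.IsBottom → ¬ (C.mate p).IsBottom

/-- The set `𝔟(C)` of the sequences `b = (b_1, …, b_m)` with `0 ≤ b_j ≤ n` that realize `C`;
the term `b_{j+1}` is `b j` for `j : Fin m`. -/
def realizingSequences (C : CatalanState m n) : Set (Fin m → ℕ) :=
  {b | (∀ j, b j ≤ n) ∧ (rowState b : KauffmanState m n).Realizes C}

/-- `b` is a maximal sequence of `C`: it realizes `C`, and its sum is the largest one. -/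
def IsMaximalSequence (C : CatalanState m n) (b : Fin m → ℕ) : Prop :=
  b ∈ C.realizingSequences ∧ ∀ b' ∈ C.realizingSequences, ∑ j, b' j ≤ ∑ j, b j

/-- The set `S(C)` of the arcs `(p, q)` of `C` with no end on the bottom boundary, where `p` is the
left end and `q` is the right end. -/
def S (C : CatalanState m n) : Set (BoundaryPoint m n × BoundaryPoint m n) :=
  {c | C.mate c.1 = c.2 ∧ ¬ c.1.IsBottom ∧ ¬ c.2.IsBottom ∧ c.1.iota < c.2.iota}

/-- The arcs of `S(C)` with `ι(p) + ι(q) ≥ 1`. -/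
def S₁ (C : CatalanState m n) : Set (BoundaryPoint m n × BoundaryPoint m n) :=
  {c ∈ C.S | 1 ≤ c.1.iota + c.2.iota}

/-- The other arcs of `S(C)`. -/
def S₂ (C : CatalanState m n) : Set (BoundaryPoint m n × BoundaryPoint m n) :=
  C.S \ C.S₁

/-- The coordinates of the right ends of the arcs in `S₁`. -/
def I₁ (C : CatalanState m n) : Set ℤ :=
  (fun c : BoundaryPoint m n × BoundaryPoint m n => c.2.iota) '' C.S₁

/-- `{1, …, m} \ I₁`. -/
def I₂ (C : CatalanState m n) : Set ℤ :=
  Set.Icc (1 : ℤ) (m : ℤ) \ C.I₁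

/-- The coordinates of the left ends of the arcs in `S₂`. -/
def I₃ (C : CatalanState m n) : Set ℤ :=
  (fun c : BoundaryPoint m n × BoundaryPoint m n => c.1.iota) '' C.S₂

end CatalanState

end LatticeCrossing

/-! Number the boundary points clockwise by `iota`, and the rows from 0. Row `t` sees `n + 2` points
in increasing order: its left end, the `n` strands from above, its right end. With `b` positive
markers followed by negative ones it joins the neighbours at positions `b` and `b + 1` and passes
the others down in order. So a sequence realizes C exactly when every row cuts off an arc of C
(`Resolves`); the rest is forced, since C is non-crossing without bottom returns
(`mem_realizingSequences_iff`).

Let row `t` cut off the arc (p, q). The visible points are distinct integers from -n - t on, so b ≤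
t + (n + p); also b ≤ n and q ≤ t + 1, so b ≤ t + (n + 1 - q). Use the second bound for high arcs (p
+ q ≥ 1) and the first for low ones. Each arc without bottom ends is cut off exactly once, so the
sum of a realizing sequence is at most a number depending only on C (`Resolves.sum_le`). Equality
means that every bound is sharp (`IsOptimal`): a high arc is cut off in the row where it ends, with
b = n, and a low arc while every point to its left is still visible. The low arcs therefore go from
right to left through the remaining rows, which gives uniqueness and the formula
(`apply_eq_of_isOptimal`).

It remains to see that this prescription (`IsSchedule`) can be carried out. Counting arcs shows that
the two ends are in reach (`mate_le`, `le_apply`) and that everything between them is gone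
(`exists_of_mem_Ioo`). Realizability enters only through the fact that at most `n` arcs leave the
first `t` levels (`card_mate_notMem_le`). -/

namespace LatticeCrossing

/-! ### Points seen by successive rows -/

section Row

/-- The points that the row `t` of the lattice crossing sees, from left to right: its left end, the
points `f 0, …, f (n - 1)` coming from above, and its right end. -/
def extendRow (n t : ℕ) (f : ℕ → ℤ) (k : ℕ) : ℤ :=
  if k = 0 then -(n : ℤ) - t else if k ≤ n then f (k - 1) else (t : ℤ) + 1

/-- The coordinates of the boundary points to which the `n` vertical segments between the rows
`t - 1` and `t` lead upwards, for the Kauffman state with row sequence `β`. -/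
def front (n : ℕ) (β : ℕ → ℕ) : ℕ → ℕ → ℤ
  | 0, k => 1 - (n : ℤ) + k
  | t + 1, k => extendRow n t (front n β t) (if k < β t then k else k + 2)

/-- The coordinates of the boundary points seen by the row `t`. -/
def row (n : ℕ) (β : ℕ → ℕ) (t : ℕ) : ℕ → ℤ := extendRow n t (front n β t)

variable {n : ℕ} {β : ℕ → ℕ}

lemma row_zero (t : ℕ) : row n β t 0 = -(n : ℤ) - t := by simp [row, extendRow]

lemma row_succ {t k : ℕ} (hk : k < n) : row n β t (k + 1) = front n β t k := by
  simp [row, extendRow, Nat.succ_le_of_lt hk]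

lemma row_last (t : ℕ) : row n β t (n + 1) = (t : ℤ) + 1 := by simp [row, extendRow]

lemma front_succ_of_lt {t k : ℕ} (h : k < β t) : front n β (t + 1) k = row n β t k := by
  simp [front, row, h]

lemma front_succ_of_le {t k : ℕ} (h : β t ≤ k) : front n β (t + 1) k = row n β t (k + 2) := by
  simp [front, row, Nat.not_lt.2 h]

lemma front_congr {β' : ℕ → ℕ} {t : ℕ} (h : ∀ s < t, β s = β' s) :
    front n β t = front n β' t := by
  induction t with
  | zero => rfl
  | succ t ih =>
    funext k
    simp only [front, ih fun s hs => h s (by omega), h t (by omega)]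

lemma row_congr {β' : ℕ → ℕ} {t : ℕ} (h : ∀ s < t, β s = β' s) :
    row n β t = row n β' t := by
  simp only [row, front_congr h]

lemma row_lt_row_of_front {t : ℕ} (hlt : ∀ j k, j < k → k < n → front n β t j < front n β t k)
    (hmem : ∀ k < n, 1 - (n : ℤ) - t ≤ front n β t k ∧ front n β t k ≤ t) {j k : ℕ}
    (hjk : j < k) (hk : k ≤ n + 1) : row n β t j < row n β t k := by
  have hval : ∀ i ≤ n + 1, i = 0 ∨ (∃ i', i = i' + 1 ∧ i' < n) ∨ i = n + 1 := by
    intro i hi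
    rcases i with _ | i
    · simp
    · rcases (by omega : i < n ∨ i = n) with h | h
      · exact Or.inr (Or.inl ⟨i, rfl, h⟩)
      · exact Or.inr (Or.inr (by omega))
  rcases hval j (by omega) with rfl | ⟨j', rfl, hj⟩ | rfl <;>
    rcases hval k hk with rfl | ⟨k', rfl, hk'⟩ | rfl <;> try omega
  · rw [row_zero, row_succ hk']; have := hmem k' hk'; omega
  · rw [row_zero, row_last]; omega
  · rw [row_succ hj, row_succ hk']; exact hlt _ _ (by omega) hk'
  · rw [row_succ hj, row_last]; have := hmem j' hj; omega

lemma row_mem_Icc {t : ℕ} (hβ : ∀ s < t, β s ≤ n) {k : ℕ} (hk : k ≤ n + 1) :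
    -(n : ℤ) - t ≤ row n β t k ∧ row n β t k ≤ t + 1 := by
  induction t generalizing k with
  | zero =>
    simp only [row, extendRow, front]
    split_ifs <;> omega
  | succ t ih =>
    have hb := hβ t (by omega)
    have ih' := fun {k} => ih (fun s hs => hβ s (by omega)) (k := k)
    simp only [row, extendRow]
    split_ifs with h1 h2
    · omega
    · rcases lt_or_ge (k - 1) (β t) with h | h
      · rw [front_succ_of_lt h]
        have := @ih' (k - 1) (by omega)
        omega
      · rw [front_succ_of_le h]
        have := @ih' (k - 1 + 2) (by omega)
        omega
    · omega

lemma exists_row_eq_iff_of_front {t : ℕ} (hβ : ∀ s < t, β s ≤ n)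
    (hset : ∀ x, (∃ k < n, front n β t k = x) ↔ (1 - (n : ℤ) - t ≤ x ∧ x ≤ t) ∧
      ∀ s < t, x ≠ row n β s (β s) ∧ x ≠ row n β s (β s + 1)) (x : ℤ) :
    (∃ k ≤ n + 1, row n β t k = x) ↔ (-(n : ℤ) - t ≤ x ∧ x ≤ t + 1) ∧
      ∀ s < t, x ≠ row n β s (β s) ∧ x ≠ row n β s (β s + 1) := by
  have hold : ∀ s < t, ∀ k ≤ n + 1, -(n : ℤ) - t < row n β s k ∧ row n β s k < t + 1 := by
    intro s hs k hk
    have := row_mem_Icc (β := β) (t := s) (fun r hr => hβ r (by omega)) hk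
    omega
  -- Earlier rows see only coordinates strictly between the two new ends, so these cannot have been
  -- joined yet.
  have hold' : ∀ s < t, ∀ x : ℤ, x = -(n : ℤ) - t ∨ x = t + 1 →
      x ≠ row n β s (β s) ∧ x ≠ row n β s (β s + 1) := by
    intro s hs x hx
    have hb := hβ s hs
    have h1 := hold s hs (β s) (by omega)
    have h2 := hold s hs (β s + 1) (by omega)
    omega
  constructor
  · rintro ⟨k, hk, rfl⟩
    refine ⟨row_mem_Icc hβ hk, ?_⟩
    rcases k with _ | k
    · rw [row_zero]
      exact fun s hs => hold' s hs _ (Or.inl rfl)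
    · rcases (by omega : k < n ∨ k = n) with h | rfl
      · rw [row_succ h]
        exact ((hset _).1 ⟨k, h, rfl⟩).2
      · rw [row_last]
        exact fun s hs => hold' s hs _ (Or.inr rfl)
  · rintro ⟨h1, h2⟩
    rcases (by omega : x = -(n : ℤ) - t ∨ x = t + 1 ∨ (1 - (n : ℤ) - t ≤ x ∧ x ≤ t))
      with h | h | h
    · exact ⟨0, by omega, by rw [row_zero, h]⟩
    · exact ⟨n + 1, le_rfl, by rw [row_last, h]⟩
    · obtain ⟨k, hk, rfl⟩ := (hset x).2 ⟨h, h2⟩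
      exact ⟨k + 1, by omega, row_succ hk⟩

/-- Each row adds a new smallest and a new largest point and drops the two it joins. Order and
membership go through the induction together, because dropping positions amounts to dropping
coordinates only when the row is injective. -/
lemma front_spec {t : ℕ} (hβ : ∀ s < t, β s ≤ n) :
    (∀ j k, j < k → k < n → front n β t j < front n β t k) ∧
    ∀ x, (∃ k < n, front n β t k = x) ↔ (1 - (n : ℤ) - t ≤ x ∧ x ≤ t) ∧
      ∀ s < t, x ≠ row n β s (β s) ∧ x ≠ row n β s (β s + 1) := by
  induction t with
  | zero =>
    refine ⟨fun j k hjk hk => by simp only [front]; omega, fun x => ⟨?_, ?_⟩⟩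
    · rintro ⟨k, hk, rfl⟩
      simp only [front]
      exact ⟨by omega, fun s hs => by omega⟩
    · rintro ⟨h, -⟩
      exact ⟨(x + n - 1).toNat, by omega, by simp only [front]; omega⟩
  | succ t ih =>
    obtain ⟨hlt, hset⟩ := ih fun s hs => hβ s (by omega)
    have hmem : ∀ k < n, 1 - (n : ℤ) - t ≤ front n β t k ∧ front n β t k ≤ t :=
      fun k hk => ((hset _).1 ⟨k, hk, rfl⟩).1
    have hrow : ∀ {j k}, j < k → k ≤ n + 1 → row n β t j < row n β t k :=
      fun hjk hk => row_lt_row_of_front hlt hmem hjk hk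
    have hinj : ∀ {j k}, j ≤ n + 1 → k ≤ n + 1 → row n β t j = row n β t k → j = k := by
      intro j k hj hk h
      rcases lt_trichotomy j k with h' | h' | h'
      · exact absurd h (hrow h' hk).ne
      · exact h'
      · exact absurd h (hrow h' hj).ne'
    have hb := hβ t (by omega)
    have hrs := exists_row_eq_iff_of_front (fun s hs => hβ s (by omega)) hset
    constructor
    · intro j k hjk hk
      rcases lt_or_ge j (β t) with h1 | h1 <;> rcases lt_or_ge k (β t) with h2 | h2
      · rw [front_succ_of_lt h1, front_succ_of_lt h2]; exact hrow hjk (by omega)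
      · rw [front_succ_of_lt h1, front_succ_of_le h2]; exact hrow (by omega) (by omega)
      · omega
      · rw [front_succ_of_le h1, front_succ_of_le h2]; exact hrow (by omega) (by omega)
    · intro x
      have hsplit : (∃ k < n, front n β (t + 1) k = x) ↔
          (∃ k ≤ n + 1, row n β t k = x) ∧ x ≠ row n β t (β t) ∧ x ≠ row n β t (β t + 1) := by
        constructor
        · rintro ⟨k, hk, rfl⟩
          rcases lt_or_ge k (β t) with h | h
          · rw [front_succ_of_lt h]
            exact ⟨⟨k, by omega, rfl⟩, fun e => by have := hinj (by omega) (by omega) e; omega,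
              fun e => by have := hinj (by omega) (by omega) e; omega⟩
          · rw [front_succ_of_le h]
            exact ⟨⟨k + 2, by omega, rfl⟩, fun e => by have := hinj (by omega) (by omega) e; omega,
              fun e => by have := hinj (by omega) (by omega) e; omega⟩
        · rintro ⟨⟨k, hk, rfl⟩, h1, h2⟩
          have h1' : k ≠ β t := fun e => h1 (by rw [e])
          have h2' : k ≠ β t + 1 := fun e => h2 (by rw [e])
          rcases lt_or_ge k (β t) with h | h
          · exact ⟨k, by omega, front_succ_of_lt h⟩
          · refine ⟨k - 2, by omega, ?_⟩
            rw [front_succ_of_le (by omega), show k - 2 + 2 = k by omega]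
      rw [hsplit, hrs]
      push_cast
      constructor
      · rintro ⟨⟨h1, h2⟩, h3⟩
        refine ⟨by omega, fun s hs => ?_⟩
        rcases (by omega : s < t ∨ s = t) with h | rfl
        · exact h2 s h
        · exact h3
      · rintro ⟨h1, h2⟩
        exact ⟨⟨by omega, fun s hs => h2 s (by omega)⟩, h2 t (by omega)⟩

lemma row_lt_row {t : ℕ} (hβ : ∀ s < t, β s ≤ n) {j k : ℕ} (hjk : j < k) (hk : k ≤ n + 1) :
    row n β t j < row n β t k :=
  row_lt_row_of_front (front_spec hβ).1
    (fun k hk => (((front_spec hβ).2 _).1 ⟨k, hk, rfl⟩).1) hjk hk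

lemma row_le_row {t : ℕ} (hβ : ∀ s < t, β s ≤ n) {j k : ℕ} (hjk : j ≤ k) (hk : k ≤ n + 1) :
    row n β t j ≤ row n β t k := by
  rcases hjk.eq_or_lt with rfl | h
  · exact le_rfl
  · exact (row_lt_row hβ h hk).le

lemma lt_of_row_lt_row {t : ℕ} (hβ : ∀ s < t, β s ≤ n) {j k : ℕ} (hj : j ≤ n + 1)
    (h : row n β t j < row n β t k) : j < k := by
  by_contra! hc
  exact absurd (row_le_row hβ hc hj) (not_le.2 h)

lemma row_injective {t : ℕ} (hβ : ∀ s < t, β s ≤ n) {j k : ℕ} (hj : j ≤ n + 1) (hk : k ≤ n + 1)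
    (h : row n β t j = row n β t k) : j = k := by
  rcases lt_trichotomy j k with h' | h' | h'
  · exact absurd h (row_lt_row hβ h' hk).ne
  · exact h'
  · exact absurd h (row_lt_row hβ h' hj).ne'

/-- The points seen by the row `t` are those that have come into reach and have not been joined by
an earlier row. -/
lemma exists_row_eq_iff {t : ℕ} (hβ : ∀ s < t, β s ≤ n) (x : ℤ) :
    (∃ k ≤ n + 1, row n β t k = x) ↔ (-(n : ℤ) - t ≤ x ∧ x ≤ t + 1) ∧
      ∀ s < t, x ≠ row n β s (β s) ∧ x ≠ row n β s (β s + 1) :=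
  exists_row_eq_iff_of_front hβ (front_spec hβ).2 x

lemma add_le_row {t : ℕ} (hβ : ∀ s < t, β s ≤ n) {k : ℕ} (hk : k ≤ n + 1) :
    -(n : ℤ) - t + k ≤ row n β t k := by
  induction k with
  | zero => simp [row_zero]
  | succ k ih =>
    have := ih (by omega)
    have := row_lt_row hβ (Nat.lt_add_one k) hk
    push_cast
    omega

/-- With its converse below: equality in `add_le_row` means that nothing up to this point has been
joined yet. -/
lemma row_eq_add {t : ℕ} (hβ : ∀ s < t, β s ≤ n) {k : ℕ} (hk : k ≤ n + 1)
    (hall : ∀ x, -(n : ℤ) - t ≤ x → x ≤ row n β t k → ∃ j ≤ n + 1, row n β t j = x) :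
    row n β t k = -(n : ℤ) - t + k := by
  have key : ∀ i ≤ k, row n β t i = -(n : ℤ) - t + i := by
    intro i
    induction i with
    | zero => simp [row_zero]
    | succ i ih =>
      intro hi
      have h0 := ih (by omega)
      have h1 := row_lt_row hβ (Nat.lt_add_one i) (by omega)
      have h2 := row_le_row hβ hi hk
      obtain ⟨j, hj, hj'⟩ := hall (row n β t i + 1) (by omega) (by omega)
      have h3 := lt_of_row_lt_row hβ (j := i) (k := j) (by omega) (by omega)
      have h4 := row_le_row hβ (j := i + 1) (k := j) h3 hj
      push_cast
      omega
  exact key k le_rfl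

lemma exists_row_eq_of_row_eq_add {t : ℕ} (hβ : ∀ s < t, β s ≤ n) {k : ℕ} (hk : k ≤ n + 1)
    (h : row n β t k = -(n : ℤ) - t + k) {x : ℤ} (h1 : -(n : ℤ) - t ≤ x)
    (h2 : x ≤ row n β t k) : ∃ j ≤ n + 1, row n β t j = x := by
  have key : ∀ i ≤ k, row n β t (k - i) = -(n : ℤ) - t + (k - i : ℕ) := by
    intro i
    induction i with
    | zero => simp [h]
    | succ i ih =>
      intro hi
      have h3 := ih (by omega)
      have h4 := row_lt_row hβ (show k - (i + 1) < k - i by omega) (by omega)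
      have h5 := add_le_row hβ (show k - (i + 1) ≤ n + 1 by omega)
      omega
  refine ⟨(x + n + t).toNat, by omega, ?_⟩
  have := key (k - (x + n + t).toNat) (by omega)
  rw [show k - (k - (x + n + t).toNat) = (x + n + t).toNat by omega] at this
  omega

end Row

/-! ### Reduction to an involution of the integers -/

lemma SameComponent.symm {m n : ℕ} {s : KauffmanState m n} {a b : Segment m n}
    (h : SameComponent s a b) : SameComponent s b a := Relation.EqvGen.symm _ _ h

lemma SameComponent.trans {m n : ℕ} {s : KauffmanState m n} {a b c : Segment m n}
    (h : SameComponent s a b) (h' : SameComponent s b c) : SameComponent s a c :=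
  Relation.EqvGen.trans _ _ _ h h'

lemma Smoothing.sameComponent {m n : ℕ} {s : KauffmanState m n} {a b : Segment m n}
    (h : Smoothing s a b) : SameComponent s a b := Relation.EqvGen.rel _ _ h

/-- An involution of `ℤ` that describes a non-crossing perfect matching without bottom returns on
the coordinates of the `2 (m + n)` boundary points, such that for every `t ≤ m` at most `n` of the
points on the first `t` levels have their mates on deeper levels. -/
structure IsArcDiagram (m n : ℕ) (M : ℤ → ℤ) : Prop where
  invol : ∀ x, M (M x) = x
  mem : ∀ x, 1 - (n : ℤ) - m ≤ x → x ≤ m + n → 1 - (n : ℤ) - m ≤ M x ∧ M x ≤ m + n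
  ne : ∀ x, 1 - (n : ℤ) - m ≤ x → x ≤ m + n → M x ≠ x
  noncrossing : ∀ x y, ¬ (x < y ∧ y < M x ∧ M x < M y)
  noBottom : ∀ x, (m : ℤ) < x → x ≤ m + n → M x ≤ m
  two_mul_le_card : ∀ t ≤ m, 2 * t ≤ {x ∈ Finset.Icc (1 - (n : ℤ) - t) t |
    1 - (n : ℤ) - t ≤ M x ∧ M x ≤ t}.card

namespace BoundaryPoint

variable {m n : ℕ}

lemma iota_injective : Function.Injective (iota : BoundaryPoint m n → ℤ) := by
  intro p q h
  rcases p with i | i | i | i <;> rcases q with j | j | j | j <;> simp only [iota] at h <;>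
    first | (congr 1; ext; omega) | (exfalso; omega)

lemma iota_mem (p : BoundaryPoint m n) : 1 - (n : ℤ) - m ≤ p.iota ∧ p.iota ≤ m + n := by
  rcases p with i | i | i | i <;> simp only [iota] <;> omega

lemma exists_iota_eq {x : ℤ} (h1 : 1 - (n : ℤ) - m ≤ x) (h2 : x ≤ m + n) :
    ∃ p : BoundaryPoint m n, p.iota = x := by
  by_cases ha : x ≤ -(n : ℤ)
  · exact ⟨.left ⟨(-(n : ℤ) - x).toNat, by omega⟩, by simp only [iota]; omega⟩
  by_cases hb : x ≤ 0
  · exact ⟨.top ⟨(x + n - 1).toNat, by omega⟩, by simp only [iota]; omega⟩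
  by_cases hc : x ≤ m
  · exact ⟨.right ⟨(x - 1).toNat, by omega⟩, by simp only [iota]; omega⟩
  · exact ⟨.bottom ⟨(m + n - x).toNat, by omega⟩, by simp only [iota]; omega⟩

lemma isBottom_iff (p : BoundaryPoint m n) : p.IsBottom ↔ (m : ℤ) < p.iota := by
  rcases p with i | i | i | i <;> simp [IsBottom, iota] <;> omega

end BoundaryPoint

section Cut

variable {m n : ℕ}

/-- The segment lies above the horizontal line between the rows `t - 1` and `t`, or meets it. -/
def Segment.Above (t : ℕ) : Segment m n → Prop
  | .hor i _ => (i : ℕ) < t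
  | .ver k _ => (k : ℕ) ≤ t

/-- The segment lies below the horizontal line between the rows `t - 1` and `t`, or meets it. -/
def Segment.Below (t : ℕ) : Segment m n → Prop
  | .hor i _ => t ≤ (i : ℕ)
  | .ver k _ => t ≤ (k : ℕ)

lemma SameComponent.exists_ver {s : KauffmanState m n} {t : ℕ} (ht : t ≤ m) {a b : Segment m n}
    (h : SameComponent s a b) (ha : a.Above t) (hb : b.Below t) :
    ∃ j, SameComponent s a (.ver ⟨t, by omega⟩ j) := by
  -- A smoothing changes sides only at a vertical segment of level `t`. Until one is met, both
  -- membership relations are preserved, and this alternative survives symmetry and transitivity.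
  have key : (∃ j, SameComponent s a (.ver ⟨t, by omega⟩ j)) ∨
      ((a.Above t ↔ b.Above t) ∧ (a.Below t ↔ b.Below t)) := by
    clear ha hb
    induction h with
    | refl a => simp
    | symm a b hab ih =>
      rcases ih with ⟨j, hj⟩ | ih
      · exact Or.inl ⟨j, (SameComponent.symm hab).trans hj⟩
      · exact Or.inr ⟨ih.1.symm, ih.2.symm⟩
    | trans a b c hab _ ih ih' =>
      rcases ih with ⟨j, hj⟩ | ih
      · exact Or.inl ⟨j, hj⟩
      rcases ih' with ⟨j, hj⟩ | ih'
      · exact Or.inl ⟨j, SameComponent.trans hab hj⟩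
      · exact Or.inr ⟨ih.1.trans ih'.1, ih.2.trans ih'.2⟩
    | rel a b hab =>
      have hr : ∀ k j, k = (⟨t, by omega⟩ : Fin (m + 1)) → (a = .ver k j ∨ b = .ver k j) →
          ∃ j, SameComponent s a (.ver ⟨t, by omega⟩ j) := by
        rintro k j rfl (rfl | rfl)
        · exact ⟨j, Relation.EqvGen.refl _⟩
        · exact ⟨j, hab.sameComponent⟩
      cases hab with
      | pos_upper i j h | neg_upper i j h =>
        by_cases hi : (i : ℕ) = t
        · exact Or.inl (hr i.castSucc j (by ext; simpa using hi) (Or.inl rfl))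
        · right; simp only [Segment.Above, Segment.Below, Fin.val_castSucc, and_true]; omega
      | pos_lower i j h | neg_lower i j h =>
        by_cases hi : (i : ℕ) + 1 = t
        · exact Or.inl (hr i.succ j (by ext; simpa using hi) (Or.inr rfl))
        · right; simp only [Segment.Above, Segment.Below, Fin.val_succ]; omega
  rcases key with h | h
  · exact h
  · have hb' := h.2.2 hb
    cases a with
    | hor i k => simp only [Segment.Above, Segment.Below] at ha hb'; omega
    | ver k j =>
      obtain rfl : k = ⟨t, by omega⟩ := by
        ext; exact le_antisymm ha hb'
      exact ⟨j, Relation.EqvGen.refl _⟩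

lemma BoundaryPoint.above_segment {t : ℕ} {p : BoundaryPoint m n}
    (h1 : 1 - (n : ℤ) - t ≤ p.iota) (h2 : p.iota ≤ t) : p.segment.Above t := by
  cases p <;> simp only [iota, segment, Segment.Above] at * <;> first | omega | simp

lemma BoundaryPoint.below_segment {t : ℕ} {p : BoundaryPoint m n}
    (h : ¬ (1 - (n : ℤ) - t ≤ p.iota ∧ p.iota ≤ t)) (ht : t ≤ m) : p.segment.Below t := by
  cases p <;> simp only [iota, segment, Segment.Below] at * <;> first | omega | simpa

end Cut

namespace CatalanState

variable {m n : ℕ}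

open Classical in
/-- The action of a Catalan state on the coordinates of the boundary points. -/
noncomputable def mateCoord (C : CatalanState m n) (x : ℤ) : ℤ :=
  if h : ∃ p : BoundaryPoint m n, p.iota = x then (C.mate h.choose).iota else x

lemma mateCoord_iota (C : CatalanState m n) (p : BoundaryPoint m n) :
    C.mateCoord p.iota = (C.mate p).iota := by
  have h : ∃ q : BoundaryPoint m n, q.iota = p.iota := ⟨p, rfl⟩
  rw [mateCoord, dif_pos h, BoundaryPoint.iota_injective h.choose_spec]

lemma mateCoord_of_not_exists (C : CatalanState m n) {x : ℤ}
    (h : ¬ ∃ p : BoundaryPoint m n, p.iota = x) : C.mateCoord x = x := dif_neg h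

lemma mateCoord_mateCoord (C : CatalanState m n) (x : ℤ) : C.mateCoord (C.mateCoord x) = x := by
  by_cases h : ∃ p : BoundaryPoint m n, p.iota = x
  · obtain ⟨p, rfl⟩ := h
    rw [mateCoord_iota, mateCoord_iota, C.mate_mate]
  · rw [C.mateCoord_of_not_exists h, C.mateCoord_of_not_exists h]

/-- An arc leaving the first `t` levels passes through one of the `n` vertical segments at that
height. Two such points using the same segment would be mates, although both lie in these levels. -/
lemma card_mate_notMem_le (C : CatalanState m n) {s : KauffmanState m n} (hs : s.Realizes C)
    {t : ℕ} (ht : t ≤ m) : {x ∈ Finset.Icc (1 - (n : ℤ) - t) t |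
      ¬ (1 - (n : ℤ) - t ≤ C.mateCoord x ∧ C.mateCoord x ≤ t)}.card ≤ n := by
  have key : ∀ x, x ∈ {x ∈ Finset.Icc (1 - (n : ℤ) - t) t |
      ¬ (1 - (n : ℤ) - t ≤ C.mateCoord x ∧ C.mateCoord x ≤ t)} →
      ∃ j, ∃ hj : j < n, ∃ p : BoundaryPoint m n, p.iota = x ∧
        SameComponent s p.segment (.ver ⟨t, by omega⟩ ⟨j, hj⟩) := by
    intro x hx
    rw [Finset.mem_filter, Finset.mem_Icc] at hx
    obtain ⟨p, rfl⟩ := BoundaryPoint.exists_iota_eq (m := m) (n := n) (x := x) (by omega) (by omega)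
    rw [mateCoord_iota] at hx
    have hc := (hs p (C.mate p) (C.mate_ne p).symm).1 rfl
    obtain ⟨j, hj⟩ := hc.exists_ver ht (p.above_segment hx.1.1 hx.1.2)
      ((C.mate p).below_segment hx.2 ht)
    exact ⟨j, j.2, p, rfl, hj⟩
  choose! f hf using key
  calc _ ≤ (Finset.range n).card := by
        refine Finset.card_le_card_of_injOn f (fun x hx => ?_) ?_
        · obtain ⟨hj, -⟩ := hf x hx
          simpa using hj
        · intro x hx y hy hxy
          obtain ⟨hj, p, rfl, hp⟩ := hf x hx
          obtain ⟨hj', q, rfl, hq⟩ := hf y hy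
          by_contra hne
          have hpq := (hs p q (fun h => hne (by rw [h]))).2
            (hp.trans (by simp only [hxy]; exact hq.symm))
          have hx' := (Finset.mem_filter.1 hx).2
          rw [mateCoord_iota, hpq] at hx'
          exact hx' (Finset.mem_Icc.1 (Finset.mem_filter.1 hy).1)
    _ = n := Finset.card_range n

lemma isArcDiagram (C : CatalanState m n) (hreal : C.Realizable) (hbot : C.NoBottomReturns) :
    IsArcDiagram m n C.mateCoord where
  invol := C.mateCoord_mateCoord
  mem x h1 h2 := by
    obtain ⟨p, rfl⟩ := BoundaryPoint.exists_iota_eq h1 h2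
    rw [mateCoord_iota]
    exact (C.mate p).iota_mem
  ne x h1 h2 := by
    obtain ⟨p, rfl⟩ := BoundaryPoint.exists_iota_eq h1 h2
    rw [mateCoord_iota]
    exact fun h => C.mate_ne p (BoundaryPoint.iota_injective h)
  noncrossing x y h := by
    by_cases hx : ∃ p : BoundaryPoint m n, p.iota = x
    · by_cases hy : ∃ p : BoundaryPoint m n, p.iota = y
      · obtain ⟨p, rfl⟩ := hx
        obtain ⟨q, rfl⟩ := hy
        rw [mateCoord_iota, mateCoord_iota] at h
        exact C.noncrossing p q h
      · rw [C.mateCoord_of_not_exists hy] at h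
        omega
    · rw [C.mateCoord_of_not_exists hx] at h
      omega
  noBottom x h1 h2 := by
    obtain ⟨p, rfl⟩ := BoundaryPoint.exists_iota_eq (m := m) (n := n) (x := x) (by omega) h2
    rw [mateCoord_iota]
    have := hbot p ((BoundaryPoint.isBottom_iff p).2 h1)
    rwa [BoundaryPoint.isBottom_iff, not_lt] at this
  two_mul_le_card t ht := by
    obtain ⟨s, hs⟩ := hreal
    have h1 := C.card_mate_notMem_le hs ht
    have h2 := Finset.card_filter_add_card_filter_not (s := Finset.Icc (1 - (n : ℤ) - t) t)
      (fun x => 1 - (n : ℤ) - t ≤ C.mateCoord x ∧ C.mateCoord x ≤ t)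
    rw [Int.card_Icc] at h2
    omega

end CatalanState

/-! ### Realizing sequences cut off one arc per row -/

section RowState

variable {m n : ℕ} {β : ℕ → ℕ}

lemma rowState_pos {b : Fin m → ℕ} {i : Fin m} {k : Fin n} (h : (k : ℕ) < b i) :
    (rowState b : KauffmanState m n) i k = .pos := if_pos h

lemma rowState_neg {b : Fin m → ℕ} {i : Fin m} {k : Fin n} (h : b i ≤ (k : ℕ)) :
    (rowState b : KauffmanState m n) i k = .neg := if_neg (not_lt.2 h)

/-- The boundary point with coordinate `x` lies on the same component as the segment `a`. -/
def JoinedTo (s : KauffmanState m n) (x : ℤ) (a : Segment m n) : Prop :=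
  ∃ p : BoundaryPoint m n, p.iota = x ∧ SameComponent s p.segment a

lemma JoinedTo.trans {s : KauffmanState m n} {x : ℤ} {a b : Segment m n} (h : JoinedTo s x a)
    (h' : SameComponent s a b) : JoinedTo s x b := by
  obtain ⟨p, hp, hpa⟩ := h
  exact ⟨p, hp, hpa.trans h'⟩

/-- A horizontal segment at position `k` is met from above through a positive crossing on its left
or a negative one on its right, or is an end of the row. At `k = β t` both clauses apply: there the
arc closes. -/
lemma joinedTo_hor_of_front {t : ℕ} (ht : t < m)
    (hf : ∀ k (hk : k < n), JoinedTo (rowState (fun j : Fin m => β j) : KauffmanState m n)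
      (front n β t k)
      (.ver ⟨t, by omega⟩ ⟨k, hk⟩)) :
    (∀ k (hk : k ≤ n), k ≤ β t → JoinedTo (rowState (fun j : Fin m => β j) : KauffmanState m n)
      (row n β t k)
      (.hor ⟨t, ht⟩ ⟨k, by omega⟩)) ∧
    ∀ k (hk : k ≤ n), β t ≤ k → JoinedTo (rowState (fun j : Fin m => β j) : KauffmanState m n)
      (row n β t (k + 1))
      (.hor ⟨t, ht⟩ ⟨k, by omega⟩) := by
  constructor
  · intro k hk hkb
    rcases k with _ | k
    · rw [row_zero]
      exact ⟨.left ⟨t, ht⟩, by simp only [BoundaryPoint.iota]; omega, Relation.EqvGen.refl _⟩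
    · rw [row_succ (by omega)]
      exact (hf k (by omega)).trans
        (Smoothing.pos_upper ⟨t, ht⟩ ⟨k, by omega⟩ (rowState_pos hkb)).sameComponent
  · intro k hk hkb
    rcases hk.lt_or_eq with hk | rfl
    · rw [row_succ hk]
      exact (hf k hk).trans
        (Smoothing.neg_upper ⟨t, ht⟩ ⟨k, hk⟩ (rowState_neg hkb)).sameComponent
    · rw [row_last]
      exact ⟨.right ⟨t, ht⟩, by simp only [BoundaryPoint.iota], Relation.EqvGen.refl _⟩

lemma joinedTo_front {t : ℕ} (ht : t ≤ m) {k : ℕ} (hk : k < n) :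
    JoinedTo (rowState (fun j : Fin m => β j) : KauffmanState m n)
      (front n β t k) (.ver ⟨t, by omega⟩ ⟨k, hk⟩) := by
  induction t generalizing k with
  | zero =>
    exact ⟨.top ⟨k, hk⟩, by simp only [BoundaryPoint.iota, front]; omega, Relation.EqvGen.refl _⟩
  | succ t ih =>
    obtain ⟨h1, h2⟩ := joinedTo_hor_of_front (β := β) (show t < m by omega)
      fun k hk => ih (by omega) hk
    rcases lt_or_ge k (β t) with h | h
    · rw [front_succ_of_lt h]
      exact (h1 k hk.le h.le).trans
        (Smoothing.pos_lower ⟨t, ht⟩ ⟨k, hk⟩ (rowState_pos h)).sameComponent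
    · rw [front_succ_of_le h]
      exact (h2 (k + 1) hk (by omega)).trans
        (Smoothing.neg_lower ⟨t, ht⟩ ⟨k, hk⟩ (rowState_neg h)).sameComponent

/-- The row `t` joins the `β t`-th of the points that it sees to the next one. -/
lemma joinedTo_hor {t : ℕ} (ht : t < m) (hβ : β t ≤ n) :
    JoinedTo (rowState (fun j : Fin m => β j) : KauffmanState m n) (row n β t (β t))
      (.hor ⟨t, ht⟩ ⟨β t, by omega⟩) ∧
    JoinedTo (rowState (fun j : Fin m => β j) : KauffmanState m n) (row n β t (β t + 1))
      (.hor ⟨t, ht⟩ ⟨β t, by omega⟩) := by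
  obtain ⟨h1, h2⟩ := joinedTo_hor_of_front (β := β) ht fun k hk => joinedTo_front ht.le hk
  exact ⟨h1 _ hβ le_rfl, h2 _ hβ le_rfl⟩

lemma CatalanState.mateCoord_eq_of_joinedTo {C : CatalanState m n} {s : KauffmanState m n}
    (hs : s.Realizes C) {x y : ℤ} (hne : x ≠ y) {a : Segment m n} (hx : JoinedTo s x a)
    (hy : JoinedTo s y a) : C.mateCoord x = y := by
  obtain ⟨p, rfl, hp⟩ := hx
  obtain ⟨q, rfl, hq⟩ := hy
  rw [mateCoord_iota, (hs p q (fun h => hne (by rw [h]))).2 (hp.trans hq.symm)]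

lemma CatalanState.mateCoord_row {C : CatalanState m n} (hβ : ∀ s < m, β s ≤ n)
    (hs : (rowState (fun j : Fin m => β j) : KauffmanState m n).Realizes C) {t : ℕ} (ht : t < m) :
    C.mateCoord (row n β t (β t)) = row n β t (β t + 1) := by
  obtain ⟨h1, h2⟩ := joinedTo_hor ht (hβ t ht)
  have := row_lt_row (t := t) (fun s hs => hβ s (by omega)) (Nat.lt_add_one (β t))
    (by have := hβ t ht; omega)
  exact mateCoord_eq_of_joinedTo hs this.ne h1 h2

/-- The mates of the `n` bottom points are not joined in any row, so they are among the `n`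
remaining strands. Non-crossing makes this correspondence strictly monotone, and the only such
self-map of `Fin n` is the identity. -/
lemma CatalanState.mateCoord_bottom {C : CatalanState m n} (hC : IsArcDiagram m n C.mateCoord)
    (hβ : ∀ s < m, β s ≤ n)
    (hrow : ∀ t < m, C.mateCoord (row n β t (β t)) = row n β t (β t + 1)) {k : ℕ} (hk : k < n) :
    C.mateCoord (m + n - k) = front n β m k := by
  obtain ⟨hlt, hset⟩ := front_spec hβ
  have hmem : ∀ k < n, ∃ j < n, front n β m j = C.mateCoord (m + n - k) := by
    intro k hk
    have h1 := hC.mem (m + n - k) (by omega) (by omega)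
    have h2 := hC.noBottom (m + n - k) (by omega) (by omega)
    refine (hset _).2 ⟨by omega, fun s hs => ?_⟩
    have h3 : ∀ j ≤ n + 1, row n β s j < m + n - k := by
      intro j hj
      have := (row_mem_Icc (t := s) (fun r hr => hβ r (by omega)) hj).2
      omega
    have hb := hβ s hs
    constructor <;> intro h
    · have h4 := hC.invol (m + n - k)
      rw [h, hrow s hs] at h4
      have := h3 (β s + 1) (by omega)
      omega
    · have h4 := hC.invol (m + n - k)
      rw [h, ← hrow s hs, hC.invol] at h4
      have := h3 (β s) (by omega)
      omega
  have hmono : ∀ j k, j < k → k < n →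
      C.mateCoord (m + n - j) < C.mateCoord (m + n - k) := by
    intro j k hjk hk
    have h1 := hC.noBottom (m + n - k) (by omega) (by omega)
    have h2 := hC.noncrossing (C.mateCoord (m + n - k)) (C.mateCoord (m + n - j))
    rw [hC.invol, hC.invol] at h2
    have h3 : C.mateCoord (m + n - j) ≠ C.mateCoord (m + n - k) := by
      intro h
      have := congrArg C.mateCoord h
      rw [hC.invol, hC.invol] at this
      omega
    have h4 := hC.noBottom (m + n - j) (by omega) (by omega)
    omega
  choose! g hg using hmem
  have hgm : StrictMono fun i : Fin n => (⟨g i, (hg i i.2).1⟩ : Fin n) := by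
    intro i j hij
    have h1 := hmono i j hij j.2
    rw [← (hg i i.2).2, ← (hg j j.2).2] at h1
    by_contra! hc
    have hc' : g j ≤ g i := hc
    rcases hc'.eq_or_lt with h | h
    · rw [h] at h1; omega
    · have := hlt _ _ h (hg i i.2).1; omega
  have hid := (StrictMono.range_inj hgm strictMono_id).1
    ((Finite.injective_iff_surjective.1 hgm.injective).range_eq.trans (by simp))
  have hgk : g k = k := congrArg Fin.val (congrFun hid ⟨k, hk⟩)
  rw [← (hg k hk).2, hgk]

/-- A coordinate labelling the component of each segment. -/
def segmentLabel (β : ℕ → ℕ) : Segment m n → ℤ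
  | .hor i k => if (k : ℕ) ≤ β i then row n β i k else row n β i (k + 1)
  | .ver k j => front n β k j

/-- The segment at position `β t` of row `t` is met by both points that the row joins and carries
the label of the left one. Only there can a label turn into that of its mate. -/
lemma segmentLabel_of_smoothing {M : ℤ → ℤ}
    (hrow : ∀ t < m, M (row n β t (β t)) = row n β t (β t + 1)) {a b : Segment m n}
    (h : Smoothing (rowState (fun j : Fin m => β j)) a b) :
    segmentLabel β a = segmentLabel β b ∨ M (segmentLabel β b) = segmentLabel β a := by
  have hpos : ∀ {i : Fin m} {j : Fin n},
      rowState (fun j : Fin m => β j) i j = Marker.pos → (j : ℕ) < β i := by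
    intro i j h
    by_contra hc
    simp [rowState, hc] at h
  have hneg : ∀ {i : Fin m} {j : Fin n},
      rowState (fun j : Fin m => β j) i j = Marker.neg → β i ≤ (j : ℕ) := by
    intro i j h
    by_contra! hc
    simp [rowState, hc] at h
  cases h with
  | pos_upper i j h =>
    have := hpos h
    left
    simp only [segmentLabel, Fin.val_succ, Fin.val_castSucc]
    rw [if_pos (by omega), row_succ j.2]
  | pos_lower i j h =>
    have := hpos h
    left
    simp only [segmentLabel, Fin.val_succ, Fin.val_castSucc]
    rw [if_pos (by omega), front_succ_of_lt this]
  | neg_upper i j h =>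
    have := hneg h
    simp only [segmentLabel, Fin.val_castSucc]
    split_ifs with hc
    · have e : β i = j := le_antisymm this hc
      right
      rw [← e, hrow i i.2, row_succ (by omega)]
    · left
      rw [row_succ j.2]
  | neg_lower i j h =>
    have := hneg h
    left
    simp only [segmentLabel, Fin.val_succ]
    rw [if_neg (by omega), front_succ_of_le this]

lemma segmentLabel_of_sameComponent {M : ℤ → ℤ} (hM : ∀ x, M (M x) = x)
    (hrow : ∀ t < m, M (row n β t (β t)) = row n β t (β t + 1)) {a b : Segment m n}
    (h : SameComponent (rowState (fun j : Fin m => β j)) a b) :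
    segmentLabel β a = segmentLabel β b ∨ M (segmentLabel β b) = segmentLabel β a := by
  induction h with
  | rel a b h => exact segmentLabel_of_smoothing hrow h
  | refl a => exact Or.inl rfl
  | symm a b _ ih =>
    rcases ih with h | h
    · exact Or.inl h.symm
    · exact Or.inr (by rw [← h, hM])
  | trans a b c _ _ ih ih' =>
    rcases ih with h | h <;> rcases ih' with h' | h'
    · exact Or.inl (h.trans h')
    · exact Or.inr (h'.trans h.symm)
    · exact Or.inr (by rw [← h', h])
    · exact Or.inl (by rw [← h, ← h', hM])

lemma CatalanState.realizes_rowState {C : CatalanState m n} (hC : IsArcDiagram m n C.mateCoord)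
    (hβ : ∀ s < m, β s ≤ n)
    (hrow : ∀ t < m, C.mateCoord (row n β t (β t)) = row n β t (β t + 1)) :
    (rowState (fun j : Fin m => β j) : KauffmanState m n).Realizes C := by
  have hbottom := fun {k} => mateCoord_bottom hC hβ hrow (k := k)
  -- The mate's label appears at bottom points and at right ends of rows with `β i = n`.
  have hlabel : ∀ p : BoundaryPoint m n,
      segmentLabel β p.segment = p.iota ∨ C.mateCoord p.iota = segmentLabel β p.segment := by
    rintro (i | i | i | i) <;>
      simp only [BoundaryPoint.segment, segmentLabel, BoundaryPoint.iota, Fin.val_last]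
    · left; simp only [Fin.val_zero, front]; omega
    · right
      rw [← hbottom i.2]
      congr 1
      omega
    · left
      rw [if_pos (by simp), Fin.val_zero, row_zero]
      omega
    · split_ifs with h
      · right
        have e : β i = n := le_antisymm (hβ i i.2) h
        have := hrow i i.2
        rw [e, row_last] at this
        rw [← this, hC.invol]
      · left; rw [row_last]
  have hjoin : ∀ {x y : ℤ} {a}, JoinedTo (rowState (fun j : Fin m => β j) : KauffmanState m n) x a →
      JoinedTo (rowState (fun j : Fin m => β j) : KauffmanState m n)
        y a → ∀ p q : BoundaryPoint m n,
      p.iota = x → q.iota = y →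
      SameComponent (rowState (fun j : Fin m => β j)) p.segment q.segment := by
    rintro x y a ⟨p', h1, h2⟩ ⟨q', h3, h4⟩ p q rfl rfl
    rw [BoundaryPoint.iota_injective h1] at h2
    rw [BoundaryPoint.iota_injective h3] at h4
    exact h2.trans h4.symm
  have hfront : ∀ k < n, ∀ p q : BoundaryPoint m n, p.iota = front n β m k →
      q.iota = m + n - k →
      SameComponent (rowState (fun j : Fin m => β j)) p.segment q.segment := by
    intro k hk
    refine hjoin (joinedTo_front le_rfl hk)
      ⟨.bottom ⟨k, hk⟩, by simp only [BoundaryPoint.iota]; omega, Relation.EqvGen.refl _⟩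
  intro p q hpq
  constructor
  · rintro rfl
    by_cases hp : p.iota ≤ m
    · by_cases hex : ∃ k < n, front n β m k = p.iota
      · obtain ⟨k, hk, hkp⟩ := hex
        refine hfront k hk _ _ hkp.symm ?_
        rw [← C.mateCoord_iota, ← hkp, ← hbottom hk, hC.invol]
      · rw [(front_spec hβ).2] at hex
        push Not at hex
        have h1 := p.iota_mem
        obtain ⟨t, ht, h⟩ := hex (by omega)
        obtain ⟨h3, h4⟩ := joinedTo_hor ht (hβ t ht)
        by_cases h2 : p.iota = row n β t (β t)
        · refine hjoin h3 h4 _ _ h2 ?_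
          rw [← C.mateCoord_iota, h2, hrow t ht]
        · have h2 := h h2
          refine hjoin h4 h3 _ _ h2 ?_
          rw [← C.mateCoord_iota, h2, ← hrow t ht, hC.invol]
    · have h1 := p.iota_mem
      have hk : (m + n - p.iota).toNat < n := by omega
      refine (hfront _ hk _ _ ?_ ?_).symm
      · rw [← hbottom hk, ← C.mateCoord_iota]
        congr 1
        omega
      · omega
  · intro h
    have h1 := segmentLabel_of_sameComponent hC.invol hrow h
    have hne : p.iota ≠ q.iota := fun h => hpq (BoundaryPoint.iota_injective h)
    apply BoundaryPoint.iota_injective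
    rw [← C.mateCoord_iota]
    have e := hC.invol
    rcases hlabel p with hp | hp <;> rcases hlabel q with hq | hq <;> rcases h1 with h1 | h1 <;>
      grind

end RowState

/-! ### Counting high and low arcs -/

section Ends

lemma card_filter_lt_lt {A : Finset ℤ} {x y : ℤ} (hx : x ∈ A) (h : x < y) :
    {z ∈ A | z < x}.card < {z ∈ A | z < y}.card := by
  refine Finset.card_lt_card ⟨fun z hz => ?_, fun he => ?_⟩
  · rw [Finset.mem_filter] at hz ⊢
    exact ⟨hz.1, hz.2.trans h⟩
  · have := he (Finset.mem_filter.2 ⟨hx, h⟩)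
    simp at this

lemma card_filter_gt_lt {A : Finset ℤ} {x y : ℤ} (hx : x ∈ A) (h : y < x) :
    {z ∈ A | x < z}.card < {z ∈ A | y < z}.card := by
  refine Finset.card_lt_card ⟨fun z hz => ?_, fun he => ?_⟩
  · rw [Finset.mem_filter] at hz ⊢
    exact ⟨hz.1, h.trans hz.2⟩
  · have := he (Finset.mem_filter.2 ⟨hx, h⟩)
    simp at this

lemma card_filter_lt_le {A : Finset ℤ} {x y : ℤ} (h : x ≤ y) :
    {z ∈ A | z < x}.card ≤ {z ∈ A | z < y}.card :=
  Finset.card_le_card (Finset.monotone_filter_right A fun _ _ hz => lt_of_lt_of_le hz h)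

lemma exists_card_filter_lt_eq {A : Finset ℤ} {r : ℕ} (hr : r < A.card) :
    ∃ x ∈ A, {y ∈ A | y < x}.card = r := by
  have hinj : Set.InjOn (fun x => {y ∈ A | y < x}.card) (A : Set ℤ) := by
    intro x hx x' hx' h
    simp only at h
    rcases lt_trichotomy x x' with h' | h' | h'
    · have := card_filter_lt_lt hx h'; omega
    · exact h'
    · have := card_filter_lt_lt hx' h'; omega
  have hmaps : Set.MapsTo (fun x => {y ∈ A | y < x}.card) (A : Set ℤ)
      (Finset.range A.card : Set ℕ) := by
    intro x hx
    simp only [Finset.coe_range, Set.mem_Iio]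
    exact Finset.card_lt_card ⟨Finset.filter_subset _ _, fun h => by
      simpa using (Finset.mem_filter.1 (h hx)).2⟩
  obtain ⟨x, hx, h⟩ := Finset.surjOn_of_injOn_of_card_le _ hmaps hinj (by simp)
    (show r ∈ (Finset.range A.card : Set ℕ) by simpa using hr)
  exact ⟨x, hx, h⟩

lemma exists_card_filter_gt_eq {A : Finset ℤ} {r : ℕ} (hr : r < A.card) :
    ∃ x ∈ A, {y ∈ A | x < y}.card = r := by
  obtain ⟨x, hx, h⟩ := exists_card_filter_lt_eq (A := A.image (-·)) (r := r)
    (by rwa [Finset.card_image_of_injective _ neg_injective])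
  obtain ⟨x, hx', rfl⟩ := Finset.mem_image.1 hx
  refine ⟨x, hx', ?_⟩
  rw [← h, Finset.filter_image, Finset.card_image_of_injective _ neg_injective]
  simp

/-- The right ends of the arcs without bottom ends for which the sum of the ends is positive. -/
noncomputable def highRightEnds (m : ℕ) (M : ℤ → ℤ) : Finset ℤ :=
  {q ∈ Finset.Icc 1 (m : ℤ) | M q < q ∧ 1 ≤ M q + q}

/-- The levels at which no arc ends whose ends have a positive sum. -/
noncomputable def freeLevels (m : ℕ) (M : ℤ → ℤ) : Finset ℤ :=
  Finset.Icc 1 (m : ℤ) \ highRightEnds m M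

/-- The left ends of the other arcs without bottom ends. -/
noncomputable def lowLeftEnds (m n : ℕ) (M : ℤ → ℤ) : Finset ℤ :=
  {p ∈ Finset.Icc (1 - (n : ℤ) - m) m | p < M p ∧ M p ≤ m ∧ M p + p ≤ 0}

variable {m n : ℕ} {M : ℤ → ℤ}

lemma mem_highRightEnds {q : ℤ} :
    q ∈ highRightEnds m M ↔ (1 ≤ q ∧ q ≤ m) ∧ M q < q ∧ 1 ≤ M q + q := by
  simp [highRightEnds]

lemma mem_freeLevels {x : ℤ} :
    x ∈ freeLevels m M ↔ (1 ≤ x ∧ x ≤ m) ∧ x ∉ highRightEnds m M := by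
  simp [freeLevels]

lemma mem_lowLeftEnds {p : ℤ} :
    p ∈ lowLeftEnds m n M ↔ (1 - (n : ℤ) - m ≤ p ∧ p ≤ m) ∧ p < M p ∧ M p ≤ m ∧ M p + p ≤ 0 := by
  simp [lowLeftEnds]

lemma card_high_add_card_free {x : ℤ} (h1 : 1 ≤ x) (h2 : x ≤ m + 1) :
    (({y ∈ highRightEnds m M | y < x}.card + {y ∈ freeLevels m M | y < x}.card : ℕ) : ℤ)
      = x - 1 := by
  rw [← Finset.card_union_of_disjoint]
  · have : {y ∈ highRightEnds m M | y < x} ∪ {y ∈ freeLevels m M | y < x} =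
        Finset.Icc 1 (x - 1) := by
      ext y
      simp only [Finset.mem_union, Finset.mem_filter, mem_freeLevels, Finset.mem_Icc]
      have : y ∈ highRightEnds m M → 1 ≤ y ∧ y ≤ m := fun h => (mem_highRightEnds.1 h).1
      by_cases hy : y ∈ highRightEnds m M
      · have := this hy
        simp only [hy, true_and, not_true, and_false, false_and, or_false]
        omega
      · simp only [hy, false_and, not_false_eq_true, and_true, false_or]
        omega
    rw [this, Int.card_Icc]
    omega
  · rw [Finset.disjoint_left]
    intro y hy hy'
    exact (mem_freeLevels.1 (Finset.mem_filter.1 hy').1).2 (Finset.mem_filter.1 hy).1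

namespace IsArcDiagram

lemma injective (hM : IsArcDiagram m n M) : Function.Injective M :=
  Function.LeftInverse.injective hM.invol

lemma mem_Ioo (hM : IsArcDiagram m n M) {p x : ℤ} (h1 : p < x) (h2 : x < M p) :
    p < M x ∧ M x < M p := by
  have ha := hM.noncrossing p x
  have hb := hM.noncrossing (M x) p
  rw [hM.invol] at hb
  have hc : M x ≠ p := fun h => by rw [← h, hM.invol] at h2; omega
  have hd : M x ≠ M p := fun h => by have := hM.injective h; omega
  omega

end IsArcDiagram

lemma two_mul_card_le_of_involutive {F G : Finset ℤ} (hM : ∀ x, M (M x) = x)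
    (hF : ∀ x ∈ F, M x ∉ F) (h1 : F ⊆ G) (h2 : ∀ x ∈ F, M x ∈ G) : 2 * F.card ≤ G.card := by
  have hd : Disjoint F (F.image M) := by
    rw [Finset.disjoint_left]
    intro x hx hx'
    obtain ⟨y, hy, rfl⟩ := Finset.mem_image.1 hx'
    exact hF y hy hx
  have := Finset.card_le_card (Finset.union_subset h1 (Finset.image_subset_iff.2 h2))
  rw [Finset.card_union_of_disjoint hd,
    Finset.card_image_of_injective _ (Function.LeftInverse.injective hM)] at this
  omega

lemma card_le_two_mul_of_involutive {F G : Finset ℤ} (hM : ∀ x, M (M x) = x)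
    (h : ∀ x ∈ G, x ∈ F ∨ M x ∈ F) : G.card ≤ 2 * F.card := by
  have : G ⊆ F ∪ F.image M := by
    intro x hx
    rw [Finset.mem_union, Finset.mem_image]
    rcases h x hx with h | h
    · exact Or.inl h
    · exact Or.inr ⟨_, h, hM x⟩
  have h1 := Finset.card_le_card this
  have h2 := Finset.card_union_le F (F.image M)
  have h3 : (F.image M).card ≤ F.card := Finset.card_image_le
  omega

/-- One end of each arc that is low with left end beyond `a`, or high with right end before `b`. -/
noncomputable def innerEnds (m n : ℕ) (M : ℤ → ℤ) (a b : ℤ) : Finset ℤ :=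
  {y ∈ lowLeftEnds m n M | a < y} ∪ {y ∈ highRightEnds m M | y < b}

lemma mem_innerEnds {a b x : ℤ} : x ∈ innerEnds m n M a b ↔
    (x ∈ lowLeftEnds m n M ∧ a < x) ∨ (x ∈ highRightEnds m M ∧ x < b) := by
  simp [innerEnds]

lemma card_innerEnds (a b : ℤ) : (innerEnds m n M a b).card =
    {y ∈ lowLeftEnds m n M | a < y}.card + {y ∈ highRightEnds m M | y < b}.card := by
  refine Finset.card_union_of_disjoint ?_
  rw [Finset.disjoint_left]
  intro x hx hx'
  have h1 := mem_lowLeftEnds.1 (Finset.mem_filter.1 hx).1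
  have h2 := mem_highRightEnds.1 (Finset.mem_filter.1 hx').1
  omega

namespace IsArcDiagram

lemma notMem_innerEnds (hM : IsArcDiagram m n M) {a b x : ℤ} (hx : x ∈ innerEnds m n M a b) :
    M x ∉ innerEnds m n M a b := by
  intro h
  rw [mem_innerEnds, mem_lowLeftEnds, mem_highRightEnds] at hx h
  rw [hM.invol] at h
  omega

lemma mem_or_mem (hM : IsArcDiagram m n M) {x : ℤ} (h1 : 1 - (n : ℤ) - m ≤ x) (h2 : x ≤ m)
    (h3 : M x ≤ m) : x ∈ lowLeftEnds m n M ∨ M x ∈ lowLeftEnds m n M ∨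
      x ∈ highRightEnds m M ∨ M x ∈ highRightEnds m M := by
  have h4 := hM.mem x h1 (by omega)
  have h5 := hM.ne x h1 (by omega)
  simp only [mem_lowLeftEnds, mem_highRightEnds, hM.invol]
  omega

/-- All counted arcs have both ends among the `2 (q - 1)` integers of `[2 - q, q - 1]`: the high
ones by the sign of their sums, the low ones because they lie under the arc ending at `q`. -/
lemma card_add_card_le (hM : IsArcDiagram m n M) {q : ℤ} (hq : q ∈ highRightEnds m M) :
    (({y ∈ lowLeftEnds m n M | M q < y}.card + {y ∈ highRightEnds m M | y < q}.card : ℕ) : ℤ)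
      ≤ q - 1 := by
  rw [← card_innerEnds]
  have hq' := mem_highRightEnds.1 hq
  have hG : ∀ x ∈ innerEnds m n M (M q) q, x ∈ Finset.Icc (2 - q) (q - 1) ∧
      M x ∈ Finset.Icc (2 - q) (q - 1) := by
    intro x hx
    rw [mem_innerEnds, mem_lowLeftEnds, mem_highRightEnds] at hx
    rw [Finset.mem_Icc, Finset.mem_Icc]
    rcases hx with hx | hx
    · have := hM.mem_Ioo (p := M q) (x := x) (by omega) (by rw [hM.invol]; omega)
      rw [hM.invol] at this
      omega
    · omega
  have := two_mul_card_le_of_involutive hM.invol (fun x hx => hM.notMem_innerEnds hx)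
    (fun x hx => (hG x hx).1) (fun x hx => (hG x hx).2)
  rw [Int.card_Icc] at this
  omega

/-- The points under the arc are matched among themselves. There are `M p - p - 1` of them, at least
`2 * M p - 1` since `p + M p ≤ 0`. -/
lemma le_card_add_card_of_mem (hM : IsArcDiagram m n M) {p : ℤ} (hp : p ∈ lowLeftEnds m n M) :
    M p ≤ ({y ∈ lowLeftEnds m n M | p < y}.card + {y ∈ highRightEnds m M | y < M p}.card : ℕ) := by
  rw [← card_innerEnds]
  have hp' := mem_lowLeftEnds.1 hp
  have := card_le_two_mul_of_involutive (F := innerEnds m n M p (M p))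
    (G := Finset.Ioo p (M p)) hM.invol (by
      intro x hx
      rw [Finset.mem_Ioo] at hx
      have h1 := hM.mem_Ioo hx.1 hx.2
      have := hM.mem_or_mem (x := x) (by omega) (by omega) (by omega)
      simp only [mem_innerEnds]
      tauto)
  rw [Int.card_Ioo] at this
  omega

lemma le_card_add_card (hM : IsArcDiagram m n M) {t : ℕ} (ht : t ≤ m) :
    t ≤ {y ∈ lowLeftEnds m n M | -(n : ℤ) - t < y}.card +
      {y ∈ highRightEnds m M | y < (t : ℤ) + 1}.card := by
  rw [← card_innerEnds]
  have h1 := hM.two_mul_le_card t ht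
  have := card_le_two_mul_of_involutive (F := innerEnds m n M (-(n : ℤ) - t) (t + 1))
    (G := {x ∈ Finset.Icc (1 - (n : ℤ) - t) t | 1 - (n : ℤ) - t ≤ M x ∧ M x ≤ t}) hM.invol (by
      intro x hx
      rw [Finset.mem_filter, Finset.mem_Icc] at hx
      have := hM.mem_or_mem (x := x) (by omega) (by omega) (by omega)
      simp only [mem_innerEnds]
      have ha : -(n : ℤ) - t < x := by omega
      have hb : -(n : ℤ) - t < M x := by omega
      have hc : x < t + 1 := by omega
      have hd : M x < t + 1 := by omega
      tauto)
  omega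

/-- Of the `2 * m + n` points off the bottom, `n` are mates of bottom points; the others form `m`
arcs. -/
lemma card_low_add_card_high (hM : IsArcDiagram m n M) :
    (lowLeftEnds m n M).card + (highRightEnds m M).card = m := by
  have h1 : {y ∈ lowLeftEnds m n M | -(n : ℤ) - m < y} = lowLeftEnds m n M :=
    Finset.filter_true_of_mem fun y hy => by have := mem_lowLeftEnds.1 hy; omega
  have h2 : {y ∈ highRightEnds m M | y < (m : ℤ) + 1} = highRightEnds m M :=
    Finset.filter_true_of_mem fun y hy => by have := mem_highRightEnds.1 hy; omega
  have h3 := hM.le_card_add_card le_rfl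
  have h4 := card_innerEnds (M := M) (m := m) (n := n) (-(n : ℤ) - m) (m + 1)
  rw [h1, h2] at h3 h4
  refine le_antisymm ?_ h3
  rw [← h4]
  have h5 := two_mul_card_le_of_involutive (F := innerEnds m n M (-(n : ℤ) - m) (m + 1))
    (G := {x ∈ Finset.Icc (1 - (n : ℤ) - m) m | M x ≤ m}) hM.invol
    (fun x hx => hM.notMem_innerEnds hx)
    (fun x hx => by
      rw [mem_innerEnds, mem_lowLeftEnds, mem_highRightEnds] at hx
      rw [Finset.mem_filter, Finset.mem_Icc]
      omega)
    (fun x hx => by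
      rw [mem_innerEnds, mem_lowLeftEnds, mem_highRightEnds] at hx
      rw [Finset.mem_filter, Finset.mem_Icc, hM.invol]
      omega)
  have h6 := Finset.card_filter_add_card_filter_not (s := Finset.Icc (1 - (n : ℤ) - m) m)
    (fun x => M x ≤ m)
  have h7 : ((Finset.Icc ((m : ℤ) + 1) (m + n)).image M).card ≤
      {x ∈ Finset.Icc (1 - (n : ℤ) - m) m | ¬ M x ≤ m}.card := by
    refine Finset.card_le_card ?_
    intro x hx
    obtain ⟨y, hy, rfl⟩ := Finset.mem_image.1 hx
    rw [Finset.mem_Icc] at hy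
    have h8 := hM.mem y (by omega) (by omega)
    have h9 := hM.noBottom y (by omega) (by omega)
    rw [Finset.mem_filter, Finset.mem_Icc, hM.invol]
    omega
  rw [Finset.card_image_of_injective _ hM.injective, Int.card_Icc] at h7
  rw [Int.card_Icc] at h6
  omega

lemma card_freeLevels (hM : IsArcDiagram m n M) :
    (freeLevels m M).card = (lowLeftEnds m n M).card := by
  have h := card_high_add_card_free (m := m) (M := M) (x := m + 1) (by omega) (by omega)
  have h1 : {y ∈ freeLevels m M | y < (m : ℤ) + 1} = freeLevels m M :=
    Finset.filter_true_of_mem fun y hy => by have := mem_freeLevels.1 hy; omega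
  have h2 : {y ∈ highRightEnds m M | y < (m : ℤ) + 1} = highRightEnds m M :=
    Finset.filter_true_of_mem fun y hy => by have := mem_highRightEnds.1 hy; omega
  rw [h1, h2] at h
  have := hM.card_low_add_card_high
  omega

end IsArcDiagram

/-! ### Existence of an optimal sequence -/

/-- `P t` is the left end of the arc that the row `t` is to cut off: the high arc ending at the
right end of the row, if there is one, and else the rightmost low arc not yet treated. -/
def IsSchedule (m n : ℕ) (M : ℤ → ℤ) (P : ℕ → ℤ) : Prop :=
  ∀ t < m, ((t : ℤ) + 1 ∈ highRightEnds m M ∧ P t = M (t + 1)) ∨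
    ((t : ℤ) + 1 ∈ freeLevels m M ∧ P t ∈ lowLeftEnds m n M ∧
      {y ∈ lowLeftEnds m n M | P t < y}.card = {y ∈ freeLevels m M | y < (t : ℤ) + 1}.card)

lemma IsArcDiagram.exists_isSchedule (hM : IsArcDiagram m n M) : ∃ P, IsSchedule m n M P := by
  have : ∀ t < m, ∃ p, ((t : ℤ) + 1 ∈ highRightEnds m M ∧ p = M (t + 1)) ∨
    ((t : ℤ) + 1 ∈ freeLevels m M ∧ p ∈ lowLeftEnds m n M ∧
      {y ∈ lowLeftEnds m n M | p < y}.card = {y ∈ freeLevels m M | y < (t : ℤ) + 1}.card) := by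
    intro t ht
    by_cases h : (t : ℤ) + 1 ∈ highRightEnds m M
    · exact ⟨_, Or.inl ⟨h, rfl⟩⟩
    · have hf : (t : ℤ) + 1 ∈ freeLevels m M := mem_freeLevels.2 ⟨by omega, h⟩
      have h1 : {y ∈ freeLevels m M | y < (t : ℤ) + 1}.card < (lowLeftEnds m n M).card := by
        rw [← hM.card_freeLevels]
        exact Finset.card_lt_card ⟨Finset.filter_subset _ _, fun h => by
          simpa using (Finset.mem_filter.1 (h hf)).2⟩
      obtain ⟨p, hp, h2⟩ := exists_card_filter_gt_eq h1
      exact ⟨p, Or.inr ⟨hf, hp, h2⟩⟩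
  choose! P hP using this
  exact ⟨P, hP⟩

namespace IsSchedule

variable {P : ℕ → ℤ}

lemma lt_mate (hP : IsSchedule m n M P) (hM : IsArcDiagram m n M) {t : ℕ} (ht : t < m) :
    P t < M (P t) := by
  rcases hP t ht with ⟨h1, h2⟩ | ⟨-, h2, -⟩
  · rw [h2, hM.invol]
    exact (mem_highRightEnds.1 h1).2.1
  · exact (mem_lowLeftEnds.1 h2).2.1

lemma mate_le (hP : IsSchedule m n M P) (hM : IsArcDiagram m n M) {t : ℕ} (ht : t < m) :
    M (P t) ≤ t + 1 := by
  rcases hP t ht with ⟨h1, h2⟩ | ⟨h1, h2, h3⟩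
  · rw [h2, hM.invol]
  -- The low arcs beyond `P t` are as many as the free levels before `t + 1`. With the right end
  -- beyond that level, low and high arcs together number at most `M (P t) - 1`, one too few.
  · by_contra! hc
    have h4 := hM.le_card_add_card_of_mem h2
    have h5 := mem_lowLeftEnds.1 h2
    have h6 := card_high_add_card_free (m := m) (M := M) (x := M (P t)) (by omega) (by omega)
    have h7 := card_filter_lt_le (A := freeLevels m M) hc.le
    omega

lemma le_apply (hP : IsSchedule m n M P) (hM : IsArcDiagram m n M) {t : ℕ} (ht : t < m) :
    -(n : ℤ) - t ≤ P t := by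
  rcases hP t ht with ⟨h1, h2⟩ | ⟨h1, h2, h3⟩
  · have := mem_highRightEnds.1 h1
    omega
  -- If the left end first came into reach in a later row `s`, then `s` arcs would be needed, but
  -- the free level `t + 1` is not used up by the low arcs counted, so at most `s - 1` are there.
  · by_contra! hc
    have h5 := mem_lowLeftEnds.1 h2
    obtain ⟨s, hs⟩ : ∃ s : ℕ, P t = -(n : ℤ) - s := ⟨(-(n : ℤ) - P t).toNat, by omega⟩
    have h4 := hM.le_card_add_card (t := s) (by omega)
    rw [← hs] at h4
    have h6 := card_high_add_card_free (m := m) (M := M) (x := (s : ℤ) + 1) (by omega) (by omega)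
    have h7 := card_filter_lt_lt (y := (s : ℤ) + 1) h1 (by omega)
    omega

lemma ne (hP : IsSchedule m n M P) (hM : IsArcDiagram m n M) {s t : ℕ} (hst : s < t)
    (ht : t < m) : P s ≠ P t := by
  intro h
  rcases hP s (by omega) with ⟨h1, h2⟩ | ⟨h1, h2, h3⟩ <;>
    rcases hP t ht with ⟨h1', h2'⟩ | ⟨h1', h2', h3'⟩
  · rw [h2, h2'] at h
    have := hM.injective h
    omega
  · rw [← h, h2, mem_lowLeftEnds, hM.invol] at h2'
    have := mem_highRightEnds.1 h1
    omega
  · rw [h, h2', mem_lowLeftEnds, hM.invol] at h2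
    have := mem_highRightEnds.1 h1'
    omega
  · rw [h, h3'] at h3
    have := card_filter_lt_lt h1 (show (s : ℤ) + 1 < t + 1 by omega)
    omega

/-- When the row `t` is reached, the arcs below its arc have been cut off. -/
lemma exists_of_mem_Ioo (hP : IsSchedule m n M P) (hM : IsArcDiagram m n M) {t : ℕ} (ht : t < m)
    {x : ℤ} (h1 : P t < x) (h2 : x < M (P t)) : ∃ s < t, x = P s ∨ x = M (P s) := by
  have hlow : ∀ y, P t < y → y < M (P t) → y ∈ lowLeftEnds m n M → ∃ s < t, P s = y := by
    intro y hy hy' hmem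
    have h4 : {z ∈ lowLeftEnds m n M | y < z}.card < (freeLevels m M).card := by
      rw [hM.card_freeLevels]
      exact Finset.card_lt_card ⟨Finset.filter_subset _ _, fun h => by
        simpa using (Finset.mem_filter.1 (h hmem)).2⟩
    -- `u` is the free level at which the low arc starting at `y` is scheduled.
    obtain ⟨u, hu, hu'⟩ := exists_card_filter_lt_eq h4
    obtain ⟨⟨hu1, hu2⟩, hu3⟩ := mem_freeLevels.1 hu
    obtain ⟨s, rfl⟩ : ∃ s : ℕ, u = s + 1 := ⟨(u - 1).toNat, by omega⟩
    have hs : P s = y := by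
      rcases hP s (by omega) with ⟨h, -⟩ | ⟨-, h5, h6⟩
      · exact absurd h hu3
      · rw [hu'] at h6
        rcases lt_trichotomy (P s) y with h | h | h
        · have := card_filter_gt_lt hmem h; omega
        · exact h
        · have := card_filter_gt_lt h5 h; omega
    refine ⟨s, ?_, hs⟩
    -- If `y` were not treated before row `t`, the low arcs beyond `P t`, which include `y`, would
    -- outnumber the free levels before `t + 1`.
    by_contra! hc
    rcases hP t ht with ⟨h5, h6⟩ | ⟨-, -, h6⟩
    · have h7 := hM.card_add_card_le h5
      have h8 := card_high_add_card_free (m := m) (M := M) (x := (t : ℤ) + 1) (by omega) (by omega)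
      have h9 := card_filter_lt_le (A := freeLevels m M) (show (t : ℤ) + 1 ≤ s + 1 by omega)
      rw [← h6] at h7
      have := card_filter_gt_lt hmem hy
      omega
    · have h9 := card_filter_lt_le (A := freeLevels m M) (show (t : ℤ) + 1 ≤ s + 1 by omega)
      have := card_filter_gt_lt hmem hy
      omega
  have hhigh : ∀ y, P t < y → y < M (P t) → y ∈ highRightEnds m M → ∃ s < t, M (P s) = y := by
    intro y hy hy' hmem
    have h3 := mem_highRightEnds.1 hmem
    have h4 := hP.mate_le hM ht
    obtain ⟨s, rfl⟩ : ∃ s : ℕ, y = s + 1 := ⟨(y - 1).toNat, by omega⟩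
    refine ⟨s, by omega, ?_⟩
    rcases hP s (by omega) with ⟨-, h5⟩ | ⟨h5, -, -⟩
    · rw [h5, hM.invol]
    · exact absurd hmem (mem_freeLevels.1 h5).2
  have h3 := hM.mem_Ioo h1 h2
  have h4 := hP.mate_le hM ht
  have h5 := hP.le_apply hM ht
  rcases hM.mem_or_mem (x := x) (by omega) (by omega) (by omega) with h | h | h | h
  · obtain ⟨s, hs, h⟩ := hlow x h1 h2 h
    exact ⟨s, hs, Or.inl h.symm⟩
  · obtain ⟨s, hs, h⟩ := hlow _ h3.1 h3.2 h
    exact ⟨s, hs, Or.inr (by rw [h, hM.invol])⟩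
  · obtain ⟨s, hs, h⟩ := hhigh x h1 h2 h
    exact ⟨s, hs, Or.inr h.symm⟩
  · obtain ⟨s, hs, h⟩ := hhigh _ h3.1 h3.2 h
    exact ⟨s, hs, Or.inl (hM.injective h.symm)⟩

/-- Rows are chosen one at a time: both scheduled ends are visible and nothing visible separates
them, so they are neighbours. Changing `β` at `T` leaves the rows up to `T` as they were. -/
lemma exists_row_sequence (hP : IsSchedule m n M P) (hM : IsArcDiagram m n M) :
    ∃ β : ℕ → ℕ, ∀ t < m, β t ≤ n ∧ row n β t (β t) = P t ∧ row n β t (β t + 1) = M (P t) := by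
  suffices ∀ T ≤ m, ∃ β : ℕ → ℕ, ∀ t < T, β t ≤ n ∧ row n β t (β t) = P t ∧
      row n β t (β t + 1) = M (P t) from this m le_rfl
  intro T
  induction T with
  | zero => exact fun _ => ⟨fun _ => 0, by simp⟩
  | succ T ih =>
    intro hT
    obtain ⟨β, hβ⟩ := ih (by omega)
    have hb : ∀ s < T, β s ≤ n := fun s hs => (hβ s hs).1
    have hrow := fun x => exists_row_eq_iff hb x
    have hlt := hP.lt_mate hM (t := T) (by omega)
    have h1 := hP.mate_le hM (t := T) (by omega)
    have h2 := hP.le_apply hM (t := T) (by omega)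
    obtain ⟨k, hk, hk'⟩ := (hrow (P T)).2 ⟨by omega, fun s hs => by
      rw [(hβ s hs).2.1, (hβ s hs).2.2]
      refine ⟨(hP.ne hM hs (by omega)).symm, fun h => ?_⟩
      have := hP.lt_mate hM (t := s) (by omega)
      rw [h, hM.invol] at hlt
      omega⟩
    obtain ⟨j, hj, hj'⟩ := (hrow (M (P T))).2 ⟨by omega, fun s hs => by
      rw [(hβ s hs).2.1, (hβ s hs).2.2]
      refine ⟨fun h => ?_, fun h => hP.ne hM hs (by omega) (hM.injective h).symm⟩
      have := hP.lt_mate hM (t := s) (by omega)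
      rw [← h, hM.invol] at this
      omega⟩
    have hkj : k < j := lt_of_row_lt_row hb hk (by rw [hk', hj']; exact hlt)
    have hj1 : j = k + 1 := by
      by_contra hne
      have h3 := row_lt_row hb (Nat.lt_add_one k) (by omega)
      have h4 := row_lt_row hb (show k + 1 < j by omega) hj
      obtain ⟨s, hs, h5⟩ := hP.exists_of_mem_Ioo hM (t := T) (by omega) (hk' ▸ h3) (hj' ▸ h4)
      have h6 := ((hrow _).1 ⟨k + 1, by omega, rfl⟩).2 s hs
      rw [(hβ s hs).2.1, (hβ s hs).2.2] at h6
      tauto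
    refine ⟨Function.update β T k, fun t ht => ?_⟩
    have hcongr : row n (Function.update β T k) t = row n β t :=
      row_congr fun s hs => Function.update_of_ne (by omega) _ _
    rw [hcongr]
    rcases (by omega : t < T ∨ t = T) with h | rfl
    · rw [Function.update_of_ne (by omega)]
      exact hβ t h
    · rw [Function.update_self, hk', ← hj1, hj']
      exact ⟨by omega, rfl, rfl⟩

end IsSchedule

/-- The sequence `β` cuts off an arc of the diagram in every row. -/
def Resolves (m n : ℕ) (M : ℤ → ℤ) (β : ℕ → ℕ) : Prop :=
  ∀ t < m, β t ≤ n ∧ M (row n β t (β t)) = row n β t (β t + 1)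

/-- The formula for the maximal sequence, in terms of the arcs that the rows cut off. -/
def IsOptimal (m n : ℕ) (M : ℤ → ℤ) (β : ℕ → ℕ) : Prop :=
  ∀ t < m, ((t : ℤ) + 1 ∈ highRightEnds m M ∧ row n β t (β t) = M (t + 1) ∧ β t = n) ∨
    ((t : ℤ) + 1 ∈ freeLevels m M ∧ row n β t (β t) ∈ lowLeftEnds m n M ∧
      row n β t (β t) = -(n : ℤ) - t + β t)

lemma IsArcDiagram.exists_resolves_isOptimal (hM : IsArcDiagram m n M) :
    ∃ β, Resolves m n M β ∧ IsOptimal m n M β := by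
  obtain ⟨P, hP⟩ := hM.exists_isSchedule
  obtain ⟨β, hβ⟩ := hP.exists_row_sequence hM
  refine ⟨β, fun t ht => ⟨(hβ t ht).1, by rw [(hβ t ht).2.1, (hβ t ht).2.2]⟩, fun t ht => ?_⟩
  have hb : ∀ s < t, β s ≤ n := fun s hs => (hβ s (by omega)).1
  obtain ⟨h1, h2, h3⟩ := hβ t ht
  rcases hP t ht with ⟨h4, h5⟩ | ⟨h4, h5, h6⟩
  · refine Or.inl ⟨h4, by rw [h2, h5], ?_⟩
    rw [h5, hM.invol, ← row_last (n := n) (β := β)] at h3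
    have := row_injective hb (by omega) le_rfl h3
    omega
  · refine Or.inr ⟨h4, by rwa [h2], row_eq_add hb (by omega) fun x hx hx' => ?_⟩
    rw [exists_row_eq_iff hb]
    have h7 := hP.lt_mate hM ht
    have h8 := hP.mate_le hM ht
    rw [h2] at hx'
    refine ⟨by omega, fun s hs => ?_⟩
    rw [(hβ s (by omega)).2.1, (hβ s (by omega)).2.2]
    have h9 := hP.lt_mate hM (t := s) (by omega)
    -- No arc cut off earlier starts left of a low arc. Low arcs are ordered by the schedule. Under
    -- an earlier high arc, `P t` would already have been joined; to the right of one it would be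
    -- positive, which a low left end is not.
    have hlt : P t < P s := by
      rcases hP s (by omega) with ⟨h10, h11⟩ | ⟨h10, h11, h12⟩
      · have h13 := mem_highRightEnds.1 h10
        have h14 := mem_lowLeftEnds.1 h5
        have hne := hP.ne hM hs ht
        by_contra! hc
        have hc' : P s < P t := lt_of_le_of_ne hc hne
        by_cases hq : P t < M (P s)
        · obtain ⟨r, hr, h15⟩ := hP.exists_of_mem_Ioo hM (t := s) (by omega) hc' hq
          rcases h15 with h15 | h15
          · exact hP.ne hM (by omega : r < t) ht h15.symm
          · have h16 := hP.lt_mate hM (t := r) (by omega)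
            rw [h15, hM.invol] at h7
            omega
        · rw [h11, hM.invol] at hq
          omega
      · by_contra! hc
        have hc' : P s < P t := lt_of_le_of_ne hc (hP.ne hM hs ht)
        have h13 := card_filter_lt_lt h10 (show (s : ℤ) + 1 < t + 1 by omega)
        have h14 := card_filter_gt_lt h5 hc'
        omega
    omega

end Ends

/-! ### The upper bound for the sum and its equality case -/

variable {m n : ℕ} {M : ℤ → ℤ} {β : ℕ → ℕ}

/-- An end that identifies the arc cut off by the row `t`: the right end if the arc is high, and the
left end if it is low. -/
noncomputable def arcEnd (n : ℕ) (M : ℤ → ℤ) (β : ℕ → ℕ) (t : ℕ) : ℤ :=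
  if 1 ≤ M (row n β t (β t)) + row n β t (β t) then M (row n β t (β t)) else row n β t (β t)

/-- The largest possible contribution of an arc to the sum of a sequence. -/
noncomputable def arcWeight (m n : ℕ) (M : ℤ → ℤ) (x : ℤ) : ℤ :=
  if x ∈ highRightEnds m M then n + 1 - x else n + x

lemma disjoint_high_low : Disjoint (highRightEnds m M) (lowLeftEnds m n M) := by
  rw [Finset.disjoint_left]
  intro x h1 h2
  rw [mem_highRightEnds] at h1
  rw [mem_lowLeftEnds] at h2
  omega

namespace Resolves

lemma lt_mate (hβ : Resolves m n M β) {t : ℕ} (ht : t < m) :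
    row n β t (β t) < M (row n β t (β t)) := by
  have hb := (hβ t ht).1
  rw [(hβ t ht).2]
  exact row_lt_row (fun s hs => (hβ s (by omega)).1) (Nat.lt_add_one _) (by omega)

lemma mate_le (hβ : Resolves m n M β) {t : ℕ} (ht : t < m) :
    M (row n β t (β t)) ≤ t + 1 := by
  have hb := (hβ t ht).1
  rw [(hβ t ht).2]
  exact (row_mem_Icc (fun s hs => (hβ s (by omega)).1) (by omega)).2

lemma add_le (hβ : Resolves m n M β) {t : ℕ} (ht : t < m) :
    -(n : ℤ) - t + β t ≤ row n β t (β t) := by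
  have hb := (hβ t ht).1
  exact add_le_row (fun s hs => (hβ s (by omega)).1) (by omega)

lemma ne (hβ : Resolves m n M β) {s t : ℕ} (hst : s < t) (ht : t < m) :
    row n β t (β t) ≠ row n β s (β s) := by
  have hb := (hβ t ht).1
  exact (((exists_row_eq_iff (fun s hs => (hβ s (by omega)).1) _).1
    ⟨β t, by omega, rfl⟩).2 s hst).1

lemma arcEnd_cases (hβ : Resolves m n M β) (hM : IsArcDiagram m n M) {t : ℕ} (ht : t < m) :
    (arcEnd n M β t = M (row n β t (β t)) ∧ arcEnd n M β t ∈ highRightEnds m M) ∨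
      (arcEnd n M β t = row n β t (β t) ∧ arcEnd n M β t ∈ lowLeftEnds m n M) := by
  have h1 := hβ.lt_mate ht
  have h2 := hβ.mate_le ht
  have h3 := hβ.add_le ht
  simp only [mem_highRightEnds, mem_lowLeftEnds, arcEnd]
  split_ifs with h
  · left
    rw [hM.invol]
    omega
  · right
    omega

/-- No point is joined twice, and there are exactly `m` high and low arcs, so `m` rows treat them
all. -/
lemma image_arcEnd (hβ : Resolves m n M β) (hM : IsArcDiagram m n M) :
    Set.InjOn (arcEnd n M β) (Finset.range m : Set ℕ) ∧
    (Finset.range m).image (arcEnd n M β) = highRightEnds m M ∪ lowLeftEnds m n M := by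
  have hinj : Set.InjOn (arcEnd n M β) (Finset.range m : Set ℕ) := by
    intro s hs t ht h
    simp only [Finset.coe_range, Set.mem_Iio] at hs ht
    have hrow : row n β s (β s) = row n β t (β t) := by
      have hd := Finset.disjoint_left.1 (disjoint_high_low (m := m) (n := n) (M := M))
      rcases hβ.arcEnd_cases hM hs with ⟨h1, h2⟩ | ⟨h1, h2⟩ <;>
        rcases hβ.arcEnd_cases hM ht with ⟨h3, h4⟩ | ⟨h3, h4⟩
      · exact hM.injective (by rw [← h1, ← h3, h])
      · exact absurd (h ▸ h4) (hd h2)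
      · exact absurd (h ▸ h2) (hd h4)
      · rw [← h1, ← h3, h]
    rcases lt_trichotomy s t with h' | h' | h'
    · exact absurd hrow.symm (hβ.ne h' ht)
    · exact h'
    · exact absurd hrow (hβ.ne h' hs)
  refine ⟨hinj, Finset.eq_of_subset_of_card_le ?_ ?_⟩
  · intro x hx
    obtain ⟨t, ht, rfl⟩ := Finset.mem_image.1 hx
    rw [Finset.mem_union]
    rcases hβ.arcEnd_cases hM (Finset.mem_range.1 ht) with h | h
    · exact Or.inl h.2
    · exact Or.inr h.2
  · rw [Finset.card_image_of_injOn hinj, Finset.card_range,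
      Finset.card_union_of_disjoint disjoint_high_low, add_comm, hM.card_low_add_card_high]

lemma sum_arcWeight (hβ : Resolves m n M β) (hM : IsArcDiagram m n M) :
    ∑ t ∈ Finset.range m, arcWeight m n M (arcEnd n M β t) =
      ∑ x ∈ highRightEnds m M ∪ lowLeftEnds m n M, arcWeight m n M x := by
  obtain ⟨h1, h2⟩ := hβ.image_arcEnd hM
  rw [← h2, Finset.sum_image h1]

lemma arcWeight_arcEnd (hβ : Resolves m n M β) (hM : IsArcDiagram m n M) {t : ℕ} (ht : t < m) :
    (arcEnd n M β t ∈ highRightEnds m M ∧ arcEnd n M β t = M (row n β t (β t)) ∧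
      arcWeight m n M (arcEnd n M β t) = n + 1 - M (row n β t (β t))) ∨
    (row n β t (β t) ∈ lowLeftEnds m n M ∧
      arcWeight m n M (arcEnd n M β t) = n + row n β t (β t)) := by
  rcases hβ.arcEnd_cases hM ht with ⟨h1, h2⟩ | ⟨h1, h2⟩
  · exact Or.inl ⟨h2, h1, by rw [arcWeight, if_pos h2, h1]⟩
  · refine Or.inr ⟨h1 ▸ h2, ?_⟩
    rw [arcWeight, if_neg (Finset.disjoint_right.1 disjoint_high_low h2), h1]

lemma le_add_arcWeight (hβ : Resolves m n M β) (hM : IsArcDiagram m n M) {t : ℕ} (ht : t < m) :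
    (β t : ℤ) ≤ t + arcWeight m n M (arcEnd n M β t) := by
  have h1 := (hβ t ht).1
  have h2 := hβ.mate_le ht
  have h3 := hβ.add_le ht
  rcases hβ.arcWeight_arcEnd hM ht with ⟨-, -, h⟩ | ⟨-, h⟩ <;> omega

lemma sum_le (hβ : Resolves m n M β) (hM : IsArcDiagram m n M) :
    ∑ t ∈ Finset.range m, (β t : ℤ) ≤ ∑ t ∈ Finset.range m, (t : ℤ) +
      ∑ x ∈ highRightEnds m M ∪ lowLeftEnds m n M, arcWeight m n M x := by
  rw [← hβ.sum_arcWeight hM, ← Finset.sum_add_distrib]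
  exact Finset.sum_le_sum fun t ht => hβ.le_add_arcWeight hM (Finset.mem_range.1 ht)

lemma sum_eq_of_isOptimal (hβ : Resolves m n M β) (hM : IsArcDiagram m n M)
    (h : IsOptimal m n M β) :
    ∑ t ∈ Finset.range m, (β t : ℤ) = ∑ t ∈ Finset.range m, (t : ℤ) +
      ∑ x ∈ highRightEnds m M ∪ lowLeftEnds m n M, arcWeight m n M x := by
  rw [← hβ.sum_arcWeight hM, ← Finset.sum_add_distrib]
  refine Finset.sum_congr rfl fun t ht => ?_
  rw [Finset.mem_range] at ht
  rcases h t ht with ⟨h1, h2, h3⟩ | ⟨h1, h2, h3⟩ <;>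
    rcases hβ.arcWeight_arcEnd hM ht with ⟨h4, h5, h6⟩ | ⟨h4, h6⟩
  · rw [h6, h2, hM.invol]; omega
  · rw [h2, mem_lowLeftEnds, hM.invol] at h4
    have := mem_highRightEnds.1 h1
    omega
  · rw [h5, mem_highRightEnds, hM.invol] at h4
    have := mem_lowLeftEnds.1 h2
    omega
  · omega

lemma isOptimal_of_sum_eq (hβ : Resolves m n M β) (hM : IsArcDiagram m n M)
    (h : ∑ t ∈ Finset.range m, (β t : ℤ) = ∑ t ∈ Finset.range m, (t : ℤ) +
      ∑ x ∈ highRightEnds m M ∪ lowLeftEnds m n M, arcWeight m n M x) :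
    IsOptimal m n M β := by
  rw [← hβ.sum_arcWeight hM, ← Finset.sum_add_distrib,
    Finset.sum_eq_sum_iff_of_le fun t ht => hβ.le_add_arcWeight hM (Finset.mem_range.1 ht)] at h
  have hhigh : ∀ t < m, arcEnd n M β t ∈ highRightEnds m M → arcEnd n M β t = t + 1 ∧
      row n β t (β t) = M (t + 1) ∧ β t = n := by
    intro t ht hmem
    have h1 := h t (Finset.mem_range.2 ht)
    have h2 := (hβ t ht).1
    have h3 := hβ.mate_le ht
    rcases hβ.arcWeight_arcEnd hM ht with ⟨h4, h5, h6⟩ | ⟨h4, h6⟩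
    · have h7 : M (row n β t (β t)) = t + 1 := by omega
      refine ⟨by rw [h5, h7], by rw [← h7, hM.invol], by omega⟩
    · rcases hβ.arcEnd_cases hM ht with ⟨h7, -⟩ | ⟨h7, h8⟩
      · rw [h7, mem_highRightEnds, hM.invol] at hmem
        have := mem_lowLeftEnds.1 h4
        omega
      · exact absurd h8 (Finset.disjoint_left.1 disjoint_high_low hmem)
  intro t ht
  by_cases hmem : (t : ℤ) + 1 ∈ highRightEnds m M
  · have h1 : (t : ℤ) + 1 ∈ (Finset.range m).image (arcEnd n M β) := by
      rw [(hβ.image_arcEnd hM).2]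
      exact Finset.mem_union_left _ hmem
    -- The high arc ending at `t + 1` is cut off in some row `s`; sharpness there gives `s = t`.
    obtain ⟨s, hs, h2⟩ := Finset.mem_image.1 h1
    have h3 := hhigh s (Finset.mem_range.1 hs) (h2 ▸ hmem)
    obtain rfl : s = t := by omega
    exact Or.inl ⟨hmem, h3.2⟩
  · have h1 := h t (Finset.mem_range.2 ht)
    rcases hβ.arcWeight_arcEnd hM ht with ⟨h4, -, -⟩ | ⟨h4, h6⟩
    · have h5 := (hhigh t ht h4).1
      exact absurd (h5 ▸ h4) hmem
    · exact Or.inr ⟨mem_freeLevels.2 ⟨by omega, hmem⟩, h4, by omega⟩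

/-- By sharpness, row `t` still sees every coordinate from its left end up to its cut, so a left end
joined earlier lies further right. -/
lemma row_lt_row_of_isOptimal (hβ : Resolves m n M β) (h : IsOptimal m n M β) {s t : ℕ}
    (hst : s < t) (ht : t < m)
    (ht' : (t : ℤ) + 1 ∈ freeLevels m M) : row n β t (β t) < row n β s (β s) := by
  rcases h t ht with ⟨h1, -⟩ | ⟨-, -, h1⟩
  · exact absurd h1 (mem_freeLevels.1 ht').2
  have hb : ∀ s < t, β s ≤ n := fun s hs => (hβ s (by omega)).1
  have hbt := (hβ t ht).1
  by_contra! hc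
  have h2 := hβ.add_le (t := s) (by omega)
  have h3 := exists_row_eq_of_row_eq_add hb (by omega) h1 (x := row n β s (β s)) (by omega) hc
  exact (((exists_row_eq_iff hb _).1 h3).2 s hst).1 rfl

lemma apply_eq_of_isOptimal (hβ : Resolves m n M β) (h : IsOptimal m n M β) {s : ℕ}
    (h2 : (freeLevels m M).card = s)
    (h3 : (lowLeftEnds m n M).card = s) (k : Fin s) {t : ℕ} (ht : t < m)
    (hk : (t : ℤ) + 1 = (freeLevels m M).orderEmbOfFin h2 k) :
    (β t : ℤ) = n + t + (lowLeftEnds m n M).orderEmbOfFin h3 k.rev := by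
  set i := (freeLevels m M).orderEmbOfFin h2 with hi
  let τ : Fin s → ℕ := fun k => (i k - 1).toNat
  have hτ : ∀ k, (τ k : ℤ) + 1 = i k ∧ τ k < m ∧ (τ k : ℤ) + 1 ∈ freeLevels m M := by
    intro k
    have h4 : i k ∈ freeLevels m M := Finset.orderEmbOfFin_mem _ h2 k
    have h5 := mem_freeLevels.1 h4
    have h6 : (τ k : ℤ) + 1 = i k := by simp only [τ]; omega
    exact ⟨h6, by omega, h6 ▸ h4⟩
  have hlow : ∀ k, row n β (τ k) (β (τ k)) ∈ lowLeftEnds m n M ∧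
      row n β (τ k) (β (τ k)) = -(n : ℤ) - τ k + β (τ k) := by
    intro k
    rcases h (τ k) (hτ k).2.1 with ⟨h4, -⟩ | ⟨-, h4⟩
    · exact absurd h4 (mem_freeLevels.1 (hτ k).2.2).2
    · exact h4
  -- Along the free levels the left ends decrease; reversed, they are the increasing enumeration of
  -- `lowLeftEnds`.
  have hmono : StrictMono fun k : Fin s => row n β (τ k.rev) (β (τ k.rev)) := by
    intro j k hjk
    refine hβ.row_lt_row_of_isOptimal h ?_ (hτ _).2.1 (hτ _).2.2
    have h4 : i k.rev < i j.rev := i.strictMono (Fin.rev_lt_rev.2 hjk)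
    have h5 := (hτ k.rev).1
    have h6 := (hτ j.rev).1
    omega
  have h4 := congrFun (Finset.orderEmbOfFin_unique h3 (fun k => (hlow k.rev).1) hmono) k.rev
  simp only [Fin.rev_rev] at h4
  obtain rfl : τ k = t := by have := (hτ k).1; omega
  rw [← h4, (hlow k).2]
  ring

end Resolves

/-! ### Return to Catalan states -/

namespace CatalanState

lemma mem_realizingSequences_iff {C : CatalanState m n} (hC : IsArcDiagram m n C.mateCoord) :
    (fun j : Fin m => β j) ∈ C.realizingSequences ↔ Resolves m n C.mateCoord β := by
  constructor
  · rintro ⟨h1, h2⟩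
    have h1' : ∀ s < m, β s ≤ n := fun s hs => h1 ⟨s, hs⟩
    exact fun t ht => ⟨h1' t ht, mateCoord_row h1' h2 ht⟩
  · intro h
    exact ⟨fun j => (h j j.2).1, realizes_rowState hC (fun s hs => (h s hs).1)
      fun t ht => (h t ht).2⟩

lemma exists_eq_comp_val (b : Fin m → ℕ) : ∃ β : ℕ → ℕ, b = fun j : Fin m => β j :=
  ⟨fun t => if h : t < m then b ⟨t, h⟩ else 0, by funext j; simp⟩

/-- The bound is attained by some sequence, so maximal means attaining it. -/
lemma isMaximalSequence_iff {C : CatalanState m n} (hC : IsArcDiagram m n C.mateCoord) :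
    C.IsMaximalSequence (fun j : Fin m => β j) ↔
      Resolves m n C.mateCoord β ∧ IsOptimal m n C.mateCoord β := by
  obtain ⟨β₀, h1, h2⟩ := hC.exists_resolves_isOptimal
  have hsum : ∀ γ : ℕ → ℕ, ((∑ j : Fin m, γ j : ℕ) : ℤ) = ∑ t ∈ Finset.range m, (γ t : ℤ) := by
    intro γ
    rw [Finset.sum_range]
    push_cast
    rfl
  rw [IsMaximalSequence, mem_realizingSequences_iff hC, and_congr_right_iff]
  intro h
  constructor
  · intro hmax
    refine h.isOptimal_of_sum_eq hC (le_antisymm (h.sum_le hC) ?_)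
    rw [← h1.sum_eq_of_isOptimal hC h2, ← hsum, ← hsum]
    exact_mod_cast hmax _ ((mem_realizingSequences_iff hC).2 h1)
  · intro hopt b' hb'
    obtain ⟨γ, rfl⟩ := exists_eq_comp_val b'
    have h3 := ((mem_realizingSequences_iff hC).1 hb').sum_le hC
    rw [← h.sum_eq_of_isOptimal hC hopt, ← hsum, ← hsum] at h3
    exact_mod_cast h3

variable {C : CatalanState m n}

lemma mem_S_iff {c : BoundaryPoint m n × BoundaryPoint m n} : c ∈ C.S ↔
    C.mate c.1 = c.2 ∧ c.1.iota ≤ m ∧ c.2.iota ≤ m ∧ c.1.iota < c.2.iota := by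
  simp [S, BoundaryPoint.isBottom_iff]

lemma coe_highRightEnds : (highRightEnds m C.mateCoord : Set ℤ) = C.I₁ := by
  ext x
  simp only [I₁, S₁, Finset.mem_coe, mem_highRightEnds, Set.mem_image, Set.mem_ofPred_eq,
    mem_S_iff]
  constructor
  · rintro ⟨h1, h2, h3⟩
    obtain ⟨q, rfl⟩ := BoundaryPoint.exists_iota_eq (m := m) (n := n) (x := x) (by omega) (by omega)
    rw [mateCoord_iota] at h2 h3
    exact ⟨(C.mate q, q), ⟨⟨C.mate_mate q, h2.le.trans h1.2, h1.2, h2⟩, h3⟩, rfl⟩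
  -- `ι(p) < ι(q)` and `ι(p) + ι(q) ≥ 1` force `ι(q) ≥ 1`, which is the inclusion of `I₁` in `[1,
  -- m]`.
  · rintro ⟨⟨p, q⟩, ⟨⟨hpq, h1, h2, h3⟩, h4⟩, rfl⟩
    simp only at *
    rw [mateCoord_iota, ← hpq, C.mate_mate, hpq]
    omega

lemma coe_freeLevels : (freeLevels m C.mateCoord : Set ℤ) = C.I₂ := by
  rw [freeLevels, Finset.coe_sdiff, coe_highRightEnds, Finset.coe_Icc, I₂]

lemma mem_S₂_iff {c : BoundaryPoint m n × BoundaryPoint m n} : c ∈ C.S₂ ↔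
    (C.mate c.1 = c.2 ∧ c.1.iota ≤ m ∧ c.2.iota ≤ m ∧ c.1.iota < c.2.iota) ∧
      c.1.iota + c.2.iota ≤ 0 := by
  simp only [S₂, S₁, Set.mem_sdiff, Set.mem_ofPred_eq, mem_S_iff, not_and, not_le]
  refine and_congr_right fun h => ?_
  simp only [h, and_self, true_imp_iff]
  omega

lemma coe_lowLeftEnds : (lowLeftEnds m n C.mateCoord : Set ℤ) = C.I₃ := by
  ext x
  simp only [I₃, Finset.mem_coe, mem_lowLeftEnds, Set.mem_image, mem_S₂_iff]
  constructor
  · rintro ⟨h1, h2, h3, h4⟩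
    obtain ⟨p, rfl⟩ := BoundaryPoint.exists_iota_eq (m := m) (n := n) (x := x) (by omega) (by omega)
    rw [mateCoord_iota] at h2 h3 h4
    exact ⟨(p, C.mate p), ⟨⟨rfl, h1.2, h3, h2⟩, by simpa [add_comm] using h4⟩, rfl⟩
  · rintro ⟨⟨p, q⟩, ⟨⟨hpq, h1, h2, h3⟩, h4⟩, rfl⟩
    simp only at *
    rw [mateCoord_iota, hpq]
    have := p.iota_mem
    omega

lemma card_lowLeftEnds : (lowLeftEnds m n C.mateCoord).card = C.S₂.ncard := by
  rw [← Set.ncard_coe_finset, coe_lowLeftEnds, I₃]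
  refine Set.InjOn.ncard_image ?_
  rintro ⟨p, q⟩ hc ⟨p', q'⟩ hc' h
  obtain rfl := BoundaryPoint.iota_injective h
  obtain rfl : C.mate p = q := (mem_S₂_iff.1 hc).1.1
  obtain rfl : C.mate p = q' := (mem_S₂_iff.1 hc').1.1
  rfl

end CatalanState

end LatticeCrossing

open LatticeCrossing LatticeCrossing.CatalanState in
theorem corollary4p12 (m n : ℕ) (C : LatticeCrossing.CatalanState m n)
    (hreal : C.Realizable) (hbot : C.NoBottomReturns) :
    (∃! b : Fin m → ℕ, C.IsMaximalSequence b) ∧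
    C.I₁ ⊆ Set.Icc (1 : ℤ) (m : ℤ) ∧
    ∃ (i l : Fin C.S₂.ncard → ℤ),
      (StrictMono i ∧ Set.range i = C.I₂) ∧
      (StrictAnti l ∧ Set.range l = C.I₃) ∧
      ∀ b : Fin m → ℕ, C.IsMaximalSequence b →
        (∀ j : Fin m, (j : ℤ) + 1 ∈ C.I₁ → b j = n) ∧
        (∀ (k : Fin C.S₂.ncard) (j : Fin m), (j : ℤ) + 1 = i k →
          (b j : ℤ) = n + (i k - 1) + l k) := by
  have hC := C.isArcDiagram hreal hbot
  have hlow := card_lowLeftEnds (C := C)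
  have hfree := hC.card_freeLevels.trans hlow
  have hhigh : ∀ β : ℕ → ℕ, IsOptimal m n C.mateCoord β → ∀ j : Fin m,
      (j : ℤ) + 1 ∈ highRightEnds m C.mateCoord → β j = n := by
    intro β h j hj
    rcases h j j.2 with ⟨-, -, h⟩ | ⟨h, -⟩
    · exact h
    · exact absurd hj (mem_freeLevels.1 h).2
  refine ⟨?_, ?_, (freeLevels m C.mateCoord).orderEmbOfFin hfree,
    fun k => (lowLeftEnds m n C.mateCoord).orderEmbOfFin hlow k.rev,
    ⟨OrderEmbedding.strictMono _, ?_⟩, ⟨?_, ?_⟩, ?_⟩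
  · obtain ⟨β₀, h₀⟩ := hC.exists_resolves_isOptimal
    refine ⟨fun j => β₀ j, (isMaximalSequence_iff hC).2 h₀, fun b hb => ?_⟩
    obtain ⟨β, rfl⟩ := exists_eq_comp_val b
    have h := (isMaximalSequence_iff hC).1 hb
    funext j
    by_cases hj : (j : ℤ) + 1 ∈ highRightEnds m C.mateCoord
    · rw [hhigh β h.2 j hj, hhigh β₀ h₀.2 j hj]
    -- Every other level is in the enumeration, so the formula determines both sequences there.
    · have hj' : (j : ℤ) + 1 ∈ freeLevels m C.mateCoord := mem_freeLevels.2 ⟨by omega, hj⟩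
      rw [← Finset.mem_coe, ← Finset.range_orderEmbOfFin _ hfree] at hj'
      obtain ⟨k, hk⟩ := hj'
      have h1 := h.1.apply_eq_of_isOptimal h.2 hfree hlow k j.2 hk.symm
      have h2 := h₀.1.apply_eq_of_isOptimal h₀.2 hfree hlow k j.2 hk.symm
      omega
  · rw [← coe_highRightEnds]
    exact fun x hx => (mem_highRightEnds.1 hx).1
  · rw [Finset.range_orderEmbOfFin, coe_freeLevels]
  · exact fun j k hjk => (OrderEmbedding.strictMono _) (Fin.rev_lt_rev.2 hjk)
  · rw [← coe_lowLeftEnds, ← Finset.range_orderEmbOfFin _ hlow]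
    exact Fin.rev_surjective.range_comp _
  · intro b hb
    obtain ⟨β, rfl⟩ := exists_eq_comp_val b
    have h := (isMaximalSequence_iff hC).1 hb
    refine ⟨fun j hj => hhigh β h.2 j ?_, fun k j hk => ?_⟩
    · rwa [← Finset.mem_coe, coe_highRightEnds]
    · rw [h.1.apply_eq_of_isOptimal h.2 hfree hlow k j.2 hk, ← hk]
      ring
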